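/- Let $d$ be the dimension, $\mu_0\in\mathbb R^d$, $\lambda>0$, $\Psi\in\mathbb R^{d\times d}$ symmetric positive definite and $\nu>d-1$. Write $|\cdot|$ for the determinant, and let $$\Gamma_d(a)=\int_{S\succ0}e^{-\mathrm{Tr}\,S}\,|S|^{a-\frac{d+1}{2}}\,dS$$ be the multivariate gamma function, where $dS=\prod_{i\le j}dS_{ij}$ is Lebesgue measure on symmetric matrices; let $\psi=\Gamma'/\Gamma$ be the digamma function. The normal-inverse-Wishart (NIW) distribution with parameters $\mu_0,\lambda,\Psi,\nu$ has, with respect to $d\mu\,d\Sigma$ on $\mathbb R^d\times\{\Sigma\succ0\}$, the density $$p(\mu,\Sigma)=\frac{\lambda^{d/2}|\Psi|^{\nu/2}|\Sigma|^{-(\nu+d+2)/2}}{(2\pi)^{d/2}2^{\nu d/2}\Gamma_d(\nu/2)}\exp\Big\{-\tfrac12\mathrm{Tr}(\Psi\Sigma^{-1})-\tfrac\lambda2(\mu-\mu_0)^\top\Sigma^{-1}(\mu-\mu_0)\Big\}.$$ Let $(a,b,\ldots)$ denote concatenation of vectors, and put $$s(\mu,\Sigma)=\Big(-\tfrac12\mathrm{vec}(\Sigma^{-1}),\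 \Sigma^{-1}\mu,\ -\tfrac12\mu^\top\Sigma^{-1}\mu,\ -\tfrac12\log|\Sigma|\Big),$$ $$\eta=\big(\mathrm{vec}(\Psi+\lambda\mu_0\mu_0^\top),\ \lambda\mu_0,\ \lambda,\ \nu\big),$$ and, for $\eta=(\eta_1,\eta_2,\eta_3,\eta_4)\in\mathbb R^{d^2}\times\mathbb R^d\times\mathbb R\times\mathbb R$, with $\eta_1$ read as a $d\times d$ matrix inside the determinant, $$A(\eta)=-\frac d2\log\eta_3-\frac{\eta_4}2\log\Big|\eta_1-\frac{\eta_2\eta_2^\top}{\eta_3}\Big|+\frac d2\log(2\pi)+\frac{\eta_4d}2\log2+\log\Gamma_d\Big(\frac{\eta_4}2\Big).$$ Then $p$ is a probability density and has the exponential family form $$p(\mu,\Sigma)=|\Sigma|^{-\frac{d+2}2}\exp\{\eta\cdot s(\mu,\Sigma)-A(\eta)\}.$$ Moreover, $s$ is integrable under $p$, $A$ is differentiable at $\eta$ as a function on $\mathbb R^{d^2}\times\mathbb R^d\times\mathbb R\times\mathbb R$ (with the entries of $\eta_1$ as $d^2$ independent coordinates), and $$E_p[s(\mu,\Sigma)]=\nabla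 A(\eta)=(m_1,m_2,m_3,m_4),$$ where $$m_1=-\frac\nu2\mathrm{vec}(\Psi^{-1}),\qquad m_2=\nu\Psi^{-1}\mu_0,\qquad m_3=-\frac d{2\lambda}-\frac\nu2\mathrm{Tr}(\Psi^{-1}\mu_0\mu_0^\top),$$ $$m_4=-\frac12\log|\Psi|+\frac d2\log2+\frac12\sum_{i=0}^{d-1}\psi\Big(\frac{\nu-i}2\Big).$$ -/

import Mathlib

open MeasureTheory Matrix
open scoped BigOperators

noncomputable section

namespace NIW

/-- Real matrices carry the product (that is, Borel) σ-algebra of their entries. -/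
instance instMeasurableSpaceMatrix (d : ℕ) : MeasurableSpace (Matrix (Fin d) (Fin d) ℝ) :=
  inferInstanceAs (MeasurableSpace (Fin d → Fin d → ℝ))

/-- The positions `(i, j)` with `i ≤ j`: the free coordinates of a symmetric `d × d` matrix. -/
abbrev UpperIdx (d : ℕ) : Type := {p : Fin d × Fin d // p.1 ≤ p.2}

/-- The symmetric matrix with the given entries on and above the diagonal. -/
def symOfUpper {d : ℕ} (v : UpperIdx d → ℝ) : Matrix (Fin d) (Fin d) ℝ :=
  Matrix.of fun i j => v ⟨(min i j, max i j), min_le_max⟩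

theorem measurable_symOfUpper (d : ℕ) : Measurable (symOfUpper (d := d)) :=
  measurable_pi_lambda _ fun _ => measurable_pi_lambda _ fun _ => measurable_pi_apply _

/-- The standard Lebesgue measure `∏_{i ≤ j} dS_{ij}` on symmetric `d × d` matrices,
as a measure on all `d × d` matrices. -/
def symLebesgue (d : ℕ) : Measure (Matrix (Fin d) (Fin d) ℝ) :=
  Measure.map symOfUpper (volume : Measure (UpperIdx d → ℝ))

/-- The Lebesgue measure on the cone of symmetric positive definite matrices. -/
def posDefLebesgue (d : ℕ) : Measure (Matrix (Fin d) (Fin d) ℝ) :=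
  (symLebesgue d).restrict {S | S.PosDef}

instance instSFinitePosDefLebesgue (d : ℕ) : SFinite (posDefLebesgue d) := by
  unfold posDefLebesgue symLebesgue; infer_instance

/-- The multivariate gamma function
`Γ_d(a) = ∫_{S ≻ 0} exp (- Tr S) |S| ^ (a - (d + 1) / 2) dS`. -/
def multiGamma (d : ℕ) (a : ℝ) : ℝ :=
  ∫ S, Real.exp (-S.trace) * S.det ^ (a - ((d : ℝ) + 1) / 2) ∂(posDefLebesgue d)

/-- The digamma function `ψ = Γ' / Γ` of a real variable. -/
def digamma (x : ℝ) : ℝ := logDeriv Real.Gamma x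

/-- The density of the normal-inverse-Wishart distribution at `(μ, S)`,
for `S` positive definite. -/
def pdf {d : ℕ} (μ₀ : Fin d → ℝ) (lam : ℝ) (Ψ : Matrix (Fin d) (Fin d) ℝ) (ν : ℝ)
    (μ : Fin d → ℝ) (S : Matrix (Fin d) (Fin d) ℝ) : ℝ :=
  (lam ^ ((d : ℝ) / 2) * Ψ.det ^ (ν / 2) * S.det ^ (-(ν + d + 2) / 2)) /
      ((2 * Real.pi) ^ ((d : ℝ) / 2) * 2 ^ (ν * d / 2) * multiGamma d (ν / 2)) *
    Real.exp (-(1 / 2) * (Ψ * S⁻¹).trace - lam / 2 * ((μ - μ₀) ⬝ᵥ (S⁻¹ *ᵥ (μ - μ₀))))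

/-- The normal-inverse-Wishart distribution: the measure with density `pdf` with respect to
`dμ dS` on `ℝ^d × {S ≻ 0}`. -/
def law {d : ℕ} (μ₀ : Fin d → ℝ) (lam : ℝ) (Ψ : Matrix (Fin d) (Fin d) ℝ) (ν : ℝ) :
    Measure ((Fin d → ℝ) × Matrix (Fin d) (Fin d) ℝ) :=
  ((volume : Measure (Fin d → ℝ)).prod (posDefLebesgue d)).withDensity
    fun x => ENNReal.ofReal (pdf μ₀ lam Ψ ν x.1 x.2)

/-- The parameter space `ℝ^(d²) × ℝ^d × ℝ × ℝ = ℝ^(d² + d + 2)`, with its Euclidean structure. -/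
abbrev Param (d : ℕ) : Type :=
  EuclideanSpace ℝ ((Fin d × Fin d) ⊕ (Fin d ⊕ (Unit ⊕ Unit)))

/-- Concatenation `(a₁, a₂, a₃, a₄)` of vectors. -/
def concat {d : ℕ} (a₁ : Fin d × Fin d → ℝ) (a₂ : Fin d → ℝ) (a₃ a₄ : ℝ) : Param d :=
  WithLp.toLp 2 (Sum.elim a₁ (Sum.elim a₂ (Sum.elim (fun _ => a₃) (fun _ => a₄))))

/-- The first block of a parameter vector, read as a matrix (the inverse of `vec`). -/
def block₁ {d : ℕ} (η : Param d) : Matrix (Fin d) (Fin d) ℝ :=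
  Matrix.of fun i j => η (Sum.inl (j, i))

/-- The second block of a parameter vector. -/
def block₂ {d : ℕ} (η : Param d) : Fin d → ℝ := fun i => η (Sum.inr (Sum.inl i))

/-- The third block of a parameter vector. -/
def block₃ {d : ℕ} (η : Param d) : ℝ := η (Sum.inr (Sum.inr (Sum.inl ())))

/-- The fourth block of a parameter vector. -/
def block₄ {d : ℕ} (η : Param d) : ℝ := η (Sum.inr (Sum.inr (Sum.inr ())))

/-- The sufficient statistics
`s(μ, S) = (-½ vec S⁻¹, S⁻¹ μ, -½ μᵀ S⁻¹ μ, -½ log |S|)`. -/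
def suffStat {d : ℕ} (μ : Fin d → ℝ) (S : Matrix (Fin d) (Fin d) ℝ) : Param d :=
  concat (-(1 / 2 : ℝ) • vec S⁻¹) (S⁻¹ *ᵥ μ) (-(1 / 2) * (μ ⬝ᵥ (S⁻¹ *ᵥ μ)))
    (-(1 / 2) * Real.log S.det)

/-- The natural parameters `η = (vec (Ψ + λ μ₀ μ₀ᵀ), λ μ₀, λ, ν)`. -/
def natParam {d : ℕ} (μ₀ : Fin d → ℝ) (lam : ℝ) (Ψ : Matrix (Fin d) (Fin d) ℝ) (ν : ℝ) :
    Param d :=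
  concat (vec (Ψ + lam • vecMulVec μ₀ μ₀)) (lam • μ₀) lam ν

/-- The base measure (its density) `f(μ, S) = |S| ^ (-(d + 2) / 2)`. -/
def baseDensity {d : ℕ} (S : Matrix (Fin d) (Fin d) ℝ) : ℝ := S.det ^ (-((d : ℝ) + 2) / 2)

/-- The log partition function, as a function of the natural parameters
`η = (η₁, η₂, η₃, η₄)`. -/
def logPartition {d : ℕ} (η : Param d) : ℝ :=
  -((d : ℝ) / 2) * Real.log (block₃ η)
    - block₄ η / 2 *
      Real.log (block₁ η - (1 / block₃ η) • vecMulVec (block₂ η) (block₂ η)).det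
    + (d : ℝ) / 2 * Real.log (2 * Real.pi)
    + block₄ η * d / 2 * Real.log 2
    + Real.log (multiGamma d (block₄ η / 2))

end NIW

end

/-! The theorem is the exponential family principle "mean of the sufficient statistic = gradient of
the log partition function", once `A` is known to be the correct normalizer.

Normalization. Integrating out `μ` is a Gaussian integral and leaves the inverse Wishart integral of
`|S|^(-a-(d+1)/2) exp(-Tr(ΨS⁻¹))`, whose value is `Γ_d(a) |Ψ|^(-a)`. It is computed by induction on
`d`: a positive definite matrix of size `n + 1` is `[[w + uᵀZu, (Zu)ᵀ], [Zu, Z]]` with `Z ≻ 0`, `w >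
0` and `u` free, the Jacobian being `|Z|` (`lintegral_posDefLebesgue_succ`). Writing `Ψ` in the same
form splits the integrand into a Gaussian in `u`, a gamma integral in `1/w` and the same problem for
`Z` (`trace_border_mul_inv_border`), so no change of variables `S ↦ S⁻¹` on matrices is needed. The
same induction turns `Γ_d` into a product of gamma functions, which makes its logarithm
differentiable.

Mean. Tilting the density at `η` by `exp(t⟨v, s⟩)` gives, up to a constant, the density at `η + tv`.
Normalization there says that the moment generating function of `⟨v, s⟩` is `exp(A(η + tv) - A(η))`
near `t = 0`; finiteness gives integrability, and the derivative at `0` gives the mean. The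
derivative of `A` is computed by hand, with Jacobi's formula for the determinant.

The point of care is that `A` has `d²` independent matrix coordinates, while `η + tv` is a parameter
of the family only if the first block of `v` is symmetric. Tilting is therefore done for symmetric
directions; the others follow because the first blocks of `s` and of the claimed mean are symmetric,
so pairing with `v` sees only its symmetric part. -/

noncomputable section

namespace NIW

/-! ### Bordered matrices -/

/-- The bordered matrix `[[x, yᵀ], [y, Z]]`. -/
def border {n : ℕ} (x : ℝ) (y : Fin n → ℝ) (Z : Matrix (Fin n) (Fin n) ℝ) :
    Matrix (Fin (n + 1)) (Fin (n + 1)) ℝ :=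
  Matrix.of (Fin.cons (Fin.cons x y) fun i => Fin.cons (y i) (Z i))

section border

variable {n : ℕ} (x : ℝ) (y : Fin n → ℝ) (Z : Matrix (Fin n) (Fin n) ℝ)

@[simp] theorem border_zero_zero : border x y Z 0 0 = x := rfl
@[simp] theorem border_zero_succ (j : Fin n) : border x y Z 0 j.succ = y j := rfl
@[simp] theorem border_succ_zero (i : Fin n) : border x y Z i.succ 0 = y i := rfl
@[simp] theorem border_succ_succ (i j : Fin n) : border x y Z i.succ j.succ = Z i j := rfl

/-- The splitting of `Fin (n + 1)` into its first element and the others. -/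
def headTail (n : ℕ) : Fin (n + 1) ≃ Unit ⊕ Fin n :=
  ((finSuccEquiv n).trans (Equiv.optionEquivSumPUnit _)).trans (Equiv.sumComm _ _)

theorem border_eq_submatrix :
    border x y Z = (fromBlocks (Matrix.of fun _ _ : Unit => x) (replicateRow Unit y)
      (replicateRow Unit y)ᴴ Z).submatrix (headTail n) (headTail n) := by
  ext i j
  refine Fin.cases ?_ (fun i => ?_) i <;> refine Fin.cases ?_ (fun j => ?_) j <;>
    simp [headTail, border]

/-- The off-diagonal block is written as `Zu` so that `Z⁻¹` cancels and the Schur complement is the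
coordinate `w` itself. -/
theorem schur_border (w : ℝ) (u : Fin n → ℝ) (hZ : Z.PosDef) :
    (Matrix.of fun _ _ : Unit => w + u ⬝ᵥ (Z *ᵥ u)) -
      replicateRow Unit (Z *ᵥ u) * Z⁻¹ * (replicateRow Unit (Z *ᵥ u))ᴴ
        = Matrix.of fun _ _ : Unit => w := by
  have hu : IsUnit Z.det := isUnit_iff_ne_zero.2 hZ.det_pos.ne'
  ext i j
  have h : (replicateRow Unit (Z *ᵥ u))ᴴ = Z * replicateCol Unit u := by
    ext i j; simp [Matrix.mul_apply, mulVec, dotProduct]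
  rw [h, Matrix.mul_assoc, ← Matrix.mul_assoc Z⁻¹, nonsing_inv_mul _ hu, Matrix.one_mul]
  simp [Matrix.mul_apply, dotProduct, mul_comm]

theorem det_border (w : ℝ) (u : Fin n → ℝ) (hZ : Z.PosDef) :
    (border (w + u ⬝ᵥ (Z *ᵥ u)) (Z *ᵥ u) Z).det = w * Z.det := by
  have := hZ.isUnit.invertible
  rw [border_eq_submatrix, det_submatrix_equiv_self, det_fromBlocks₂₂, invOf_eq_nonsing_inv,
    schur_border Z w u hZ, mul_comm]
  simp

theorem posDef_border_iff (w : ℝ) (u : Fin n → ℝ) (hZ : Z.PosDef) :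
    (border (w + u ⬝ᵥ (Z *ᵥ u)) (Z *ᵥ u) Z).PosDef ↔ 0 < w := by
  have := hZ.isUnit.invertible
  constructor
  · intro h
    have := h.det_pos
    rw [det_border Z w u hZ] at this
    exact (pos_iff_pos_of_mul_pos this).2 hZ.det_pos
  · intro hw
    have hp : (border (w + u ⬝ᵥ (Z *ᵥ u)) (Z *ᵥ u) Z).PosSemidef := by
      rw [border_eq_submatrix, posSemidef_submatrix_equiv, PosDef.fromBlocks₂₂ _ _ hZ,
        schur_border Z w u hZ]
      have : (Matrix.of fun _ _ : Unit => w) = diagonal fun _ => w := by ext; simp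
      rw [this, posSemidef_diagonal_iff]
      exact fun _ => hw.le
    rw [hp.posDef_iff_det_ne_zero, det_border Z w u hZ]
    exact (mul_pos hw hZ.det_pos).ne'

variable {x y Z} in
theorem PosDef.of_border (h : (border x y Z).PosDef) : Z.PosDef :=
  h.submatrix (Fin.succ_injective n)

theorem trace_border : (border x y Z).trace = x + Z.trace := by
  simp [trace, Fin.sum_univ_succ]

theorem inv_border {w : ℝ} (hw : w ≠ 0) (u : Fin n → ℝ) (hZ : Z.PosDef) :
    (border (w + u ⬝ᵥ (Z *ᵥ u)) (Z *ᵥ u) Z)⁻¹ =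
      border w⁻¹ (-w⁻¹ • u) (Z⁻¹ + w⁻¹ • vecMulVec u u) := by
  have hu : IsUnit Z.det := isUnit_iff_ne_zero.2 hZ.det_pos.ne'
  have hs : ∀ i j, Z i j = Z j i := fun i j => by simpa using (hZ.isHermitian.apply i j).symm
  have hvm : ∀ j, ∑ k, u k * Z k j = (Z *ᵥ u) j := fun j => by
    simp [mulVec, dotProduct, mul_comm, hs j]
  have h1 : ∀ i j, ∑ k, Z⁻¹ i k * Z k j = (1 : Matrix (Fin n) (Fin n) ℝ) i j := fun i j => by
    rw [← Matrix.mul_apply, nonsing_inv_mul _ hu]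
  have h2 : ∀ i, ∑ k, Z⁻¹ i k * (Z *ᵥ u) k = u i := fun i => by
    change (Z⁻¹ *ᵥ (Z *ᵥ u)) i = _
    rw [mulVec_mulVec, nonsing_inv_mul _ hu, one_mulVec]
  have h3 : ∑ k, u k * (Z *ᵥ u) k = u ⬝ᵥ (Z *ᵥ u) := rfl
  refine inv_eq_left_inv ?_
  ext i j
  rw [Matrix.mul_apply, Fin.sum_univ_succ]
  refine Fin.cases ?_ (fun i => ?_) i <;> refine Fin.cases ?_ (fun j => ?_) j
  · simp only [border_zero_zero, border_zero_succ, border_succ_zero, Pi.smul_apply, smul_eq_mul,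
      mul_assoc, ← Finset.mul_sum, h3, one_apply_eq]
    field_simp
    ring
  · simp only [border_zero_zero, border_zero_succ, border_succ_succ, Pi.smul_apply,
      smul_eq_mul, mul_assoc, ← Finset.mul_sum, hvm]
    rw [one_apply_ne (Fin.succ_ne_zero j).symm]
    ring
  · simp only [border_zero_zero, border_succ_succ, border_succ_zero, Pi.smul_apply,
      smul_eq_mul, Matrix.add_apply, Matrix.smul_apply, vecMulVec_apply, add_mul,
      Finset.sum_add_distrib, mul_assoc, ← Finset.mul_sum, h2, h3]
    rw [one_apply_ne (Fin.succ_ne_zero i)]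
    field_simp
    ring
  · simp only [border_succ_zero, border_zero_succ, border_succ_succ, Pi.smul_apply,
      smul_eq_mul, Matrix.add_apply, Matrix.smul_apply, vecMulVec_apply, add_mul,
      Finset.sum_add_distrib, mul_assoc, ← Finset.mul_sum, h1, hvm]
    simp [Matrix.one_apply]

theorem exists_eq_border {Ψ : Matrix (Fin (n + 1)) (Fin (n + 1)) ℝ} (hΨ : Ψ.PosDef) :
    ∃ (k : ℝ) (c : Fin n → ℝ) (Φ : Matrix (Fin n) (Fin n) ℝ), 0 < k ∧ Φ.PosDef ∧
      Ψ = border (k + c ⬝ᵥ (Φ *ᵥ c)) (Φ *ᵥ c) Φ := by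
  have hs : ∀ i j, Ψ i j = Ψ j i := fun i j => by simpa using (hΨ.isHermitian.apply i j).symm
  set Φ := Ψ.submatrix Fin.succ Fin.succ with hΦ
  have hP : Φ.PosDef := hΨ.submatrix (Fin.succ_injective n)
  have hu : IsUnit Φ.det := isUnit_iff_ne_zero.2 hP.det_pos.ne'
  -- Solves `Φc = ` (rest of the first row); `k` is then forced to be the Schur complement.
  set c := Φ⁻¹ *ᵥ fun i => Ψ 0 i.succ with hc
  have hΦc : Φ *ᵥ c = fun i => Ψ 0 i.succ := by
    rw [hc, mulVec_mulVec, mul_nonsing_inv _ hu, one_mulVec]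
  have he : Ψ = border ((Ψ 0 0 - c ⬝ᵥ (Φ *ᵥ c)) + c ⬝ᵥ (Φ *ᵥ c)) (Φ *ᵥ c) Φ := by
    rw [hΦc]
    ext i j
    refine Fin.cases ?_ (fun i => ?_) i <;> refine Fin.cases ?_ (fun j => ?_) j
    · simp
    · simp
    · simp [hs 0]
    · simp [hΦ]
  refine ⟨_, c, Φ, ?_, hP, he⟩
  rw [he, posDef_border_iff _ _ _ hP] at hΨ
  simpa using hΨ

theorem trace_border_mul_border (a b : ℝ) (p q : Fin n → ℝ) (Y : Matrix (Fin n) (Fin n) ℝ) :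
    (border a p Z * border b q Y).trace = a * b + 2 * (p ⬝ᵥ q) + (Z * Y).trace := by
  simp [trace, Matrix.mul_apply, Fin.sum_univ_succ, dotProduct, Finset.sum_add_distrib]
  ring

/-- Completing the square in `u`: the trace separates into a term in `w`, a Gaussian exponent
centred at `c`, and the trace of the same kind one size lower. -/
theorem trace_border_mul_inv_border {w : ℝ} (hw : w ≠ 0) (u c : Fin n → ℝ) (k : ℝ)
    (hZ : Z.PosDef) {Φ : Matrix (Fin n) (Fin n) ℝ} (hΦ : Φ.PosDef) :
    (border (k + c ⬝ᵥ (Φ *ᵥ c)) (Φ *ᵥ c) Φ *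
      (border (w + u ⬝ᵥ (Z *ᵥ u)) (Z *ᵥ u) Z)⁻¹).trace =
      k * w⁻¹ + (u - c) ⬝ᵥ ((w⁻¹ • Φ) *ᵥ (u - c)) + (Φ * Z⁻¹).trace := by
  rw [inv_border Z hw u hZ, trace_border_mul_border]
  have hs : c ⬝ᵥ (Φ *ᵥ u) = u ⬝ᵥ (Φ *ᵥ c) := by
    rw [dotProduct_comm, dotProduct_mulVec, ← mulVec_transpose, dotProduct_comm, dotProduct_comm]
    congr 2
    ext i j
    simpa using hΦ.isHermitian.apply j i
  have ht : (Φ * (w⁻¹ • vecMulVec u u)).trace = w⁻¹ * (u ⬝ᵥ (Φ *ᵥ u)) := by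
    rw [Matrix.mul_smul, trace_smul, mul_vecMulVec, trace_vecMulVec, dotProduct_comm, smul_eq_mul]
  rw [Matrix.mul_add, trace_add, ht, smul_mulVec, dotProduct_smul, mulVec_sub, dotProduct_smul,
    sub_dotProduct, dotProduct_sub, dotProduct_sub, hs, dotProduct_comm (Φ *ᵥ c) u]
  simp only [smul_eq_mul]
  ring

end border

/-! ### Measurability -/

section measurability

variable {d : ℕ}

instance instBorelSpaceMatrix (d : ℕ) : BorelSpace (Matrix (Fin d) (Fin d) ℝ) :=
  inferInstanceAs (BorelSpace (Fin d → Fin d → ℝ))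

theorem measurable_matrix_apply (i j : Fin d) :
    Measurable fun S : Matrix (Fin d) (Fin d) ℝ => S i j :=
  (measurable_pi_apply j).comp (measurable_pi_apply i)

theorem measurable_det : Measurable fun S : Matrix (Fin d) (Fin d) ℝ => S.det :=
  (continuous_id.matrix_det).measurable

theorem measurable_trace : Measurable fun S : Matrix (Fin d) (Fin d) ℝ => S.trace :=
  (continuous_id.matrix_trace).measurable

/-- Inversion need not be continuous at singular matrices, but adjugate over determinant is
measurable everywhere. -/
theorem measurable_inv : Measurable fun S : Matrix (Fin d) (Fin d) ℝ => S⁻¹ := by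
  refine measurable_pi_lambda _ fun i => measurable_pi_lambda _ fun j => ?_
  have : ∀ S : Matrix (Fin d) (Fin d) ℝ, S⁻¹ i j = S.det⁻¹ * S.adjugate i j := fun S => by
    rw [inv_def, Ring.inverse_eq_inv']; rfl
  simp only [this]
  exact measurable_det.inv.mul (continuous_id.matrix_adjugate.matrix_elem i j).measurable

theorem measurableSet_posDef : MeasurableSet {S : Matrix (Fin d) (Fin d) ℝ | S.PosDef} := by
  -- The closed semidefinite cone minus the zero set of the determinant.
  have h : {S : Matrix (Fin d) (Fin d) ℝ | S.PosDef} =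
      {S | S.IsHermitian ∧ ∀ x : Fin d → ℝ, 0 ≤ x ⬝ᵥ (S *ᵥ x)} ∩ {S | S.det ≠ 0} := by
    ext S
    have := posSemidef_iff_dotProduct_mulVec (M := S)
    simp only [star_trivial] at this
    simp only [Set.mem_ofPred_eq, Set.mem_inter_iff, ← this]
    exact ⟨fun h => ⟨h.posSemidef, h.det_pos.ne'⟩, fun h => h.1.posDef_iff_det_ne_zero.2 h.2⟩
  rw [h]
  refine MeasurableSet.inter (IsClosed.measurableSet ?_) ?_
  · refine IsClosed.and (isClosed_eq continuous_id.matrix_conjTranspose continuous_id) ?_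
    simp only [Set.ofPred_forall]
    refine isClosed_iInter fun x => isClosed_le continuous_const ?_
    exact continuous_const.dotProduct (continuous_id.matrix_mulVec continuous_const)
  · exact (measurableSet_singleton (0 : ℝ)).compl.preimage measurable_det

theorem ae_posDef : ∀ᵐ S ∂(posDefLebesgue d), S.PosDef :=
  ae_restrict_mem measurableSet_posDef

theorem measurable_border {n : ℕ} {α : Type*} [MeasurableSpace α] {f : α → ℝ}
    {g : α → Fin n → ℝ} {h : α → Matrix (Fin n) (Fin n) ℝ} (hf : Measurable f)
    (hg : Measurable g) (hh : Measurable h) : Measurable fun a => border (f a) (g a) (h a) := by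
  refine measurable_pi_lambda _ fun i => measurable_pi_lambda _ fun j => ?_
  refine Fin.cases ?_ (fun i => ?_) i <;> refine Fin.cases ?_ (fun j => ?_) j
  · simpa using hf
  · exact (measurable_pi_apply j).comp hg
  · exact (measurable_pi_apply i).comp hg
  · exact (measurable_matrix_apply i j).comp hh

end measurability

/-! ### Integration over symmetric matrices of size `n + 1` -/

section bordering

open scoped ENNReal

variable {n : ℕ}

/-- The free coordinates of a symmetric matrix of size `n + 1`: the corner, the rest of the
first row, and the free coordinates of the remaining symmetric matrix of size `n`. -/
def upperIdxSucc (n : ℕ) : Unit ⊕ (Fin n ⊕ UpperIdx n) → UpperIdx (n + 1)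
  | .inl _ => ⟨(0, 0), le_rfl⟩
  | .inr (.inl j) => ⟨(0, j.succ), Fin.zero_le _⟩
  | .inr (.inr p) => ⟨(p.1.1.succ, p.1.2.succ), Fin.succ_le_succ_iff.2 p.2⟩

theorem bijective_upperIdxSucc (n : ℕ) : Function.Bijective (upperIdxSucc n) := by
  constructor
  · rintro (_ | j | ⟨⟨a, b⟩, h⟩) (_ | j' | ⟨⟨a', b'⟩, h'⟩) <;>
      simp [upperIdxSucc, Fin.ext_iff]
  · rintro ⟨⟨i, j⟩, h⟩
    induction i using Fin.cases with
    | zero =>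
      induction j using Fin.cases with
      | zero => exact ⟨.inl (), rfl⟩
      | succ j => exact ⟨.inr (.inl j), rfl⟩
    | succ i =>
      induction j using Fin.cases with
      | zero => exact absurd h (by simp)
      | succ j => exact ⟨.inr (.inr ⟨(i, j), Fin.succ_le_succ_iff.1 h⟩), rfl⟩

theorem symOfUpper_eq_border (v : UpperIdx (n + 1) → ℝ) :
    symOfUpper v = border (v (upperIdxSucc n (.inl ())))
      (fun j => v (upperIdxSucc n (.inr (.inl j))))
      (symOfUpper fun p => v (upperIdxSucc n (.inr (.inr p)))) := by
  ext i j
  refine Fin.cases ?_ (fun i => ?_) i <;> refine Fin.cases ?_ (fun j => ?_) j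
  · simp [symOfUpper, upperIdxSucc]
  · simp [symOfUpper, upperIdxSucc]
  · simp [symOfUpper, upperIdxSucc]
  · simp only [symOfUpper, upperIdxSucc, of_apply, border_succ_succ]
    congr 3
    · exact (Fin.strictMono_succ.monotone.map_min).symm
    · exact (Fin.strictMono_succ.monotone.map_max).symm

/-- Tonelli, after relabelling the upper-triangular coordinates by `upperIdxSucc`. -/
theorem lintegral_symLebesgue_succ {f : Matrix (Fin (n + 1)) (Fin (n + 1)) ℝ → ℝ≥0∞}
    (hf : Measurable f) :
    ∫⁻ S, f S ∂(symLebesgue (n + 1)) =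
      ∫⁻ Z, (∫⁻ y : Fin n → ℝ, ∫⁻ x : ℝ, f (border x y Z)) ∂(symLebesgue n) := by
  set e := Equiv.ofBijective _ (bijective_upperIdxSucc n)
  have h1 := volume_measurePreserving_piCongrLeft (fun _ => ℝ) e
  have h2 := volume_measurePreserving_sumPiEquivProdPi_symm
    (fun _ : Unit ⊕ (Fin n ⊕ UpperIdx n) => ℝ)
  have h3 := (volume_measurePreserving_sumPiEquivProdPi_symm
    (fun _ : Fin n ⊕ UpperIdx n => ℝ))
  have h4 := (volume_preserving_funUnique Unit ℝ).symm
  have h5 := h1.comp (h2.comp (h4.prod h3))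
  have hb : Measurable fun q : ℝ × (Fin n → ℝ) × Matrix (Fin n) (Fin n) ℝ =>
      f (border q.1 q.2.1 q.2.2) :=
    hf.comp (measurable_border measurable_fst measurable_snd.fst measurable_snd.snd)
  have hb' : Measurable fun q : ℝ × (Fin n → ℝ) × (UpperIdx n → ℝ) =>
      f (border q.1 q.2.1 (symOfUpper q.2.2)) :=
    hb.comp (measurable_fst.prodMk (measurable_snd.fst.prodMk
      ((measurable_symOfUpper n).comp measurable_snd.snd)))
  have hc : Measurable fun Z : Matrix (Fin n) (Fin n) ℝ =>
      ∫⁻ y : Fin n → ℝ, ∫⁻ x : ℝ, f (border x y Z) := by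
    refine Measurable.lintegral_prod_right' (f := fun q : Matrix (Fin n) (Fin n) ℝ × (Fin n → ℝ) =>
      ∫⁻ x : ℝ, f (border x q.2 q.1)) ?_
    refine Measurable.lintegral_prod_right'
      (f := fun q : (Matrix (Fin n) (Fin n) ℝ × (Fin n → ℝ)) × ℝ => f (border q.2 q.1.2 q.1.1)) ?_
    exact hb.comp (measurable_snd.prodMk (measurable_fst.snd.prodMk measurable_fst.fst))
  rw [symLebesgue, symLebesgue, lintegral_map hf (measurable_symOfUpper _),
    lintegral_map hc (measurable_symOfUpper _)]
  refine (h5.lintegral_comp (hf.comp (measurable_symOfUpper _))).symm.trans ?_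
  have h6 : ∀ q : ℝ × (Fin n → ℝ) × (UpperIdx n → ℝ),
      symOfUpper ((MeasurableEquiv.piCongrLeft (fun _ => ℝ) e ∘
        (MeasurableEquiv.sumPiEquivProdPi fun _ : Unit ⊕ (Fin n ⊕ UpperIdx n) => ℝ).symm ∘
        Prod.map (MeasurableEquiv.funUnique Unit ℝ).symm
          (MeasurableEquiv.sumPiEquivProdPi fun _ : Fin n ⊕ UpperIdx n => ℝ).symm) q) =
      border q.1 q.2.1 (symOfUpper q.2.2) := by
    intro q
    have h7 : ∀ (z : Unit ⊕ (Fin n ⊕ UpperIdx n) → ℝ) i,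
        MeasurableEquiv.piCongrLeft (fun _ => ℝ) e z (upperIdxSucc n i) = z i := fun z i =>
      Equiv.piCongrLeft_apply_apply (fun _ => ℝ) e z i
    rw [symOfUpper_eq_border]
    simp only [Function.comp_apply, h7]
    rfl
  simp only [Function.comp_apply, Function.comp_def] at h6 ⊢
  simp only [h6]
  rw [Measure.volume_eq_prod, lintegral_prod_symm' _ hb',
    lintegral_prod_symm' _ (Measurable.lintegral_prod_left' hb')]

/-- A symmetric positive definite matrix of size `n + 1` is parametrized by a positive definite
matrix `Z` of size `n`, a vector `u` and the Schur complement `w > 0`. -/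
theorem lintegral_posDefLebesgue_succ {f : Matrix (Fin (n + 1)) (Fin (n + 1)) ℝ → ℝ≥0∞}
    (hf : Measurable f) :
    ∫⁻ S, f S ∂(posDefLebesgue (n + 1)) =
      ∫⁻ Z, (∫⁻ w in Set.Ioi (0 : ℝ), ∫⁻ u : Fin n → ℝ,
        ENNReal.ofReal Z.det * f (border (w + u ⬝ᵥ (Z *ᵥ u)) (Z *ᵥ u) Z))
          ∂(posDefLebesgue n) := by
  rw [posDefLebesgue, ← lintegral_indicator measurableSet_posDef,
    lintegral_symLebesgue_succ (hf.indicator measurableSet_posDef), posDefLebesgue,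
    ← lintegral_indicator measurableSet_posDef]
  refine lintegral_congr fun Z => ?_
  by_cases hZ : Z.PosDef
  swap
  · rw [Set.indicator_of_notMem (by exact hZ)]
    -- A principal submatrix of a positive definite matrix is positive definite, so both sides
    -- vanish at this `Z`.
    have : ∀ x y, border x y Z ∉ {S : Matrix (Fin (n + 1)) (Fin (n + 1)) ℝ | S.PosDef} :=
      fun x y h => hZ (PosDef.of_border h)
    simp [Set.indicator_of_notMem (this _ _)]
  rw [Set.indicator_of_mem (by exact hZ)]
  set F := ({S | S.PosDef} : Set (Matrix (Fin (n + 1)) (Fin (n + 1)) ℝ)).indicator f with hF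
  have hFm : Measurable F := hf.indicator measurableSet_posDef
  have hmB : Measurable fun q : (Fin n → ℝ) × ℝ => F (border q.2 q.1 Z) :=
    hFm.comp (measurable_border measurable_snd measurable_fst measurable_const)
  have hL : Measurable fun u : Fin n → ℝ => Z *ᵥ u :=
    (continuous_const.matrix_mulVec continuous_id).measurable
  have hdet := hZ.det_pos
  have hmap := Real.map_matrix_volume_pi_eq_smul_volume_pi hdet.ne'
  -- The substitution `y = Zu` produces the Jacobian `det Z`.
  have h1 : ∫⁻ y : Fin n → ℝ, ∫⁻ x : ℝ, F (border x y Z) =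
      ENNReal.ofReal Z.det * ∫⁻ u : Fin n → ℝ, ∫⁻ x : ℝ, F (border x (Z *ᵥ u) Z) := by
    have h2 : ∫⁻ u : Fin n → ℝ, ∫⁻ x : ℝ, F (border x (Z *ᵥ u) Z) =
        ∫⁻ y, (∫⁻ x : ℝ, F (border x y Z)) ∂(Measure.map (toLin' Z) volume) := by
      exact (lintegral_map (Measurable.lintegral_prod_right' hmB) hL).symm
    rw [h2, hmap, lintegral_smul_measure, smul_eq_mul, ← mul_assoc, ← ENNReal.ofReal_mul hdet.le,
      abs_of_pos (inv_pos.2 hdet), mul_inv_cancel₀ hdet.ne', ENNReal.ofReal_one, one_mul]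
  -- Translating `x` by `uᵀZu` turns positive definiteness into `w > 0`.
  have h3 : ∀ u : Fin n → ℝ, ∫⁻ x : ℝ, F (border x (Z *ᵥ u) Z) =
      ∫⁻ w in Set.Ioi (0 : ℝ), f (border (w + u ⬝ᵥ (Z *ᵥ u)) (Z *ᵥ u) Z) := by
    intro u
    rw [← lintegral_add_right_eq_self _ (u ⬝ᵥ (Z *ᵥ u)), ← lintegral_indicator measurableSet_Ioi]
    refine lintegral_congr fun w => ?_
    by_cases hw : 0 < w
    · rw [Set.indicator_of_mem (by exact hw), hF,
        Set.indicator_of_mem (by exact (posDef_border_iff Z w u hZ).2 hw)]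
    · rw [Set.indicator_of_notMem (by exact hw), hF,
        Set.indicator_of_notMem (by exact (posDef_border_iff Z w u hZ).not.2 hw)]
  have hmf : Measurable fun q : (Fin n → ℝ) × ℝ =>
      f (border (q.2 + q.1 ⬝ᵥ (Z *ᵥ q.1)) (Z *ᵥ q.1) Z) := by
    refine hf.comp (measurable_border (measurable_snd.add ?_) (hL.comp measurable_fst)
      measurable_const)
    exact (continuous_fst.dotProduct (continuous_const.matrix_mulVec continuous_fst)).measurable
  rw [h1]
  simp only [h3]
  rw [lintegral_lintegral_swap hmf.aemeasurable, ← lintegral_const_mul]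
  · refine lintegral_congr fun w => ?_
    rw [lintegral_const_mul]
    exact hmf.comp (measurable_id.prodMk measurable_const)
  · exact Measurable.lintegral_prod_left' hmf

end bordering

/-! ### Gaussian and gamma integrals -/

section gaussian

open scoped MatrixOrder in
-- Factor `M = BᵀB` and substitute `v = Bu`; the standard Gaussian then splits over coordinates.
theorem lintegral_exp_neg_quadratic {n : ℕ} {M : Matrix (Fin n) (Fin n) ℝ} (hM : M.PosDef)
    (c : Fin n → ℝ) :
    ∫⁻ u : Fin n → ℝ, ENNReal.ofReal (Real.exp (-((u - c) ⬝ᵥ (M *ᵥ (u - c))))) =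
      ENNReal.ofReal (Real.pi ^ ((n : ℝ) / 2) * M.det ^ (-(1 / 2) : ℝ)) := by
  rw [lintegral_sub_right_eq_self
    (fun u : Fin n → ℝ => ENNReal.ofReal (Real.exp (-(u ⬝ᵥ (M *ᵥ u))))) c]
  obtain ⟨B, hB⟩ := CStarAlgebra.nonneg_iff_eq_star_mul_self.mp hM.posSemidef.nonneg
  have hdet : M.det = B.det ^ 2 := by
    rw [hB, det_mul, star_eq_conjTranspose, det_conjTranspose]; simp [sq]
  have hpos := hM.det_pos
  have hB0 : B.det ≠ 0 := fun h => by rw [hdet, h] at hpos; simp at hpos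
  have hq : ∀ u, u ⬝ᵥ (M *ᵥ u) = (B *ᵥ u) ⬝ᵥ (B *ᵥ u) := fun u => by
    rw [hB, ← mulVec_mulVec, star_eq_conjTranspose, conjTranspose_eq_transpose_of_trivial,
      dotProduct_mulVec, vecMul_transpose]
  have hg : Measurable fun v : Fin n → ℝ => ENNReal.ofReal (Real.exp (-(v ⬝ᵥ v))) := by
    have : Continuous fun v : Fin n → ℝ => v ⬝ᵥ v := continuous_id.dotProduct continuous_id
    exact (Real.continuous_exp.comp this.neg).measurable.ennreal_ofReal
  have hL : Measurable fun u : Fin n → ℝ => B *ᵥ u :=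
    (continuous_const.matrix_mulVec continuous_id).measurable
  have h1 : ∫⁻ u : Fin n → ℝ, ENNReal.ofReal (Real.exp (-(u ⬝ᵥ (M *ᵥ u)))) =
      ∫⁻ v, ENNReal.ofReal (Real.exp (-(v ⬝ᵥ v))) ∂(Measure.map (toLin' B) volume) := by
    simp only [hq]
    exact (lintegral_map hg hL).symm
  have he : (fun v : Fin n → ℝ => Real.exp (-(v ⬝ᵥ v))) =
      fun v => ∏ i, Real.exp (-1 * v i ^ 2) := by
    ext v
    rw [← Real.exp_sum]
    simp [dotProduct, sq]
  have hi : Integrable fun v : Fin n → ℝ => Real.exp (-(v ⬝ᵥ v)) := by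
    rw [he]
    exact Integrable.fintype_prod fun _ => integrable_exp_neg_mul_sq one_pos
  have h2 : ∫ v : Fin n → ℝ, Real.exp (-(v ⬝ᵥ v)) = Real.pi ^ ((n : ℝ) / 2) := by
    rw [he, integral_fintype_prod_volume_eq_pow (fun x : ℝ => Real.exp (-1 * x ^ 2)),
      integral_gaussian, div_one, Fintype.card_fin, Real.sqrt_eq_rpow, ← Real.rpow_natCast,
      ← Real.rpow_mul Real.pi_pos.le]
    congr 1
    ring
  rw [h1, Real.map_matrix_volume_pi_eq_smul_volume_pi hB0, lintegral_smul_measure, smul_eq_mul,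
    ← ofReal_integral_eq_lintegral_ofReal hi (ae_of_all _ fun _ => (Real.exp_pos _).le), h2,
    ← ENNReal.ofReal_mul (abs_nonneg _), mul_comm]
  congr 2
  rw [Real.rpow_neg hpos.le, ← Real.sqrt_eq_rpow, hdet, Real.sqrt_sq_eq_abs, abs_inv]

theorem lintegral_rpow_mul_exp_neg {a : ℝ} (ha : 0 < a) :
    ∫⁻ w in Set.Ioi (0 : ℝ), ENNReal.ofReal (w ^ (a - 1) * Real.exp (-w)) =
      ENNReal.ofReal (Real.Gamma a) := by
  have h := Real.GammaIntegral_convergent ha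
  rw [Real.Gamma_eq_integral ha, ofReal_integral_eq_lintegral_ofReal h]
  · exact lintegral_congr fun w => by rw [mul_comm]
  · refine (ae_restrict_mem measurableSet_Ioi).mono fun w hw => ?_
    exact mul_nonneg (Real.exp_pos _).le (Real.rpow_nonneg (le_of_lt hw) _)

theorem lintegral_rpow_mul_exp_neg_inv {a k : ℝ} (ha : 0 < a) (hk : 0 < k) :
    ∫⁻ w in Set.Ioi (0 : ℝ), ENNReal.ofReal (w ^ (-a - 1) * Real.exp (-(k * w⁻¹))) =
      ENNReal.ofReal (Real.Gamma a * k ^ (-a)) := by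
  have hint := Real.integral_rpow_mul_exp_neg_mul_Ioi ha hk
  have hG := Real.Gamma_pos_of_pos ha
  have hi : IntegrableOn (fun t : ℝ => t ^ (a - 1) * Real.exp (-(k * t))) (Set.Ioi 0) := by
    -- A non-integrable function would have Bochner integral `0`, but the known value is positive.
    by_contra h
    rw [integral_undef h] at hint
    exact (mul_pos (Real.rpow_pos_of_pos (one_div_pos.2 hk) a) hG).ne hint
  -- The substitution `t = w⁻¹`, as the power map with exponent `-1`.
  have hc := integral_comp_rpow_Ioi (fun t : ℝ => t ^ (a - 1) * Real.exp (-(k * t)))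
    (by norm_num : (-1 : ℝ) ≠ 0)
  have hci := (integrableOn_Ioi_comp_rpow_iff (fun t : ℝ => t ^ (a - 1) * Real.exp (-(k * t)))
    (by norm_num : (-1 : ℝ) ≠ 0)).2 hi
  have he : ∀ w ∈ Set.Ioi (0 : ℝ), (|(-1 : ℝ)| * w ^ ((-1 : ℝ) - 1)) •
      ((w ^ (-1 : ℝ)) ^ (a - 1) * Real.exp (-(k * w ^ (-1 : ℝ)))) =
      w ^ (-a - 1) * Real.exp (-(k * w⁻¹)) := fun w hw => by
    have hw' : (0 : ℝ) < w := hw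
    rw [← Real.rpow_mul hw'.le, Real.rpow_neg_one, smul_eq_mul, ← mul_assoc, abs_neg, abs_one,
      one_mul, ← Real.rpow_add hw']
    congr 2
    ring
  rw [setIntegral_congr_fun measurableSet_Ioi he, hint] at hc
  have hci' := hci.congr_fun he measurableSet_Ioi
  rw [← ofReal_integral_eq_lintegral_ofReal hci', hc]
  · rw [one_div, Real.inv_rpow hk.le, Real.rpow_neg hk.le, mul_comm]
  · refine (ae_restrict_mem measurableSet_Ioi).mono fun w hw => ?_
    exact mul_nonneg (Real.rpow_nonneg (le_of_lt hw) _) (Real.exp_pos _).le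

end gaussian

/-! ### The multivariate gamma function -/

/-- The product formula for the multivariate gamma function. -/
def gammaProd (d : ℕ) (a : ℝ) : ℝ :=
  Real.pi ^ ((d : ℝ) * (d - 1) / 4) * ∏ i ∈ Finset.range d, Real.Gamma (a - i / 2)

theorem gammaProd_pos {d : ℕ} {a : ℝ} (ha : ((d : ℝ) - 1) / 2 < a) : 0 < gammaProd d a := by
  refine mul_pos (Real.rpow_pos_of_pos Real.pi_pos _) (Finset.prod_pos fun i hi => ?_)
  refine Real.Gamma_pos_of_pos ?_
  have : (i : ℝ) + 1 ≤ d := by exact_mod_cast Finset.mem_range.1 hi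
  linarith

theorem gammaProd_succ (n : ℕ) (a : ℝ) :
    gammaProd (n + 1) a = Real.pi ^ ((n : ℝ) / 2) * Real.Gamma (a - n / 2) * gammaProd n a := by
  rw [gammaProd, gammaProd, Finset.prod_range_succ]
  have : ((n + 1 : ℕ) : ℝ) * ((n + 1 : ℕ) - 1) / 4 = n / 2 + n * (n - 1) / 4 := by
    push_cast; ring
  rw [this, Real.rpow_add Real.pi_pos]
  ring

/-- Peeling off the first factor rather than the last shifts `a` by `1/2`, which is the recursion
met by the inverse Wishart integral; `gammaProd_succ` is the one met by `Γ_d` itself. -/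
theorem gammaProd_succ' (n : ℕ) (a : ℝ) :
    gammaProd (n + 1) a = Real.pi ^ ((n : ℝ) / 2) * Real.Gamma a * gammaProd n (a - 1 / 2) := by
  rw [gammaProd, gammaProd, Finset.prod_range_succ']
  have : ((n + 1 : ℕ) : ℝ) * ((n + 1 : ℕ) - 1) / 4 = n / 2 + n * (n - 1) / 4 := by
    push_cast; ring
  rw [this, Real.rpow_add Real.pi_pos]
  have h : ∀ i : ℕ, a - ((i + 1 : ℕ) : ℝ) / 2 = a - 1 / 2 - i / 2 := fun i => by push_cast; ring
  simp only [h]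
  simp
  ring

/-- The lower integral of a product of nonnegative real functions, one factor being constant. -/
theorem lintegral_ofReal_const_mul {α : Type*} [MeasurableSpace α] (μ : Measure α) {c : ℝ}
    (hc : 0 ≤ c) (f : α → ℝ) :
    ∫⁻ x, ENNReal.ofReal (c * f x) ∂μ = ENNReal.ofReal c * ∫⁻ x, ENNReal.ofReal (f x) ∂μ := by
  simp only [ENNReal.ofReal_mul hc]
  exact lintegral_const_mul' _ _ ENNReal.ofReal_ne_top

theorem lintegral_posDefLebesgue_zero (f : Matrix (Fin 0) (Fin 0) ℝ → ENNReal) :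
    ∫⁻ S, f S ∂(posDefLebesgue 0) = f 1 := by
  have h : ∀ S : Matrix (Fin 0) (Fin 0) ℝ, S = 1 := fun S => Subsingleton.elim _ _
  have hs : {S : Matrix (Fin 0) (Fin 0) ℝ | S.PosDef} = Set.univ :=
    Set.eq_univ_of_forall fun S => by rw [h S]; exact PosDef.one
  have hc : f = fun _ => f 1 := funext fun S => by rw [h S]
  rw [hc, lintegral_const, posDefLebesgue, hs, Measure.restrict_univ, symLebesgue,
    Measure.map_apply (measurable_symOfUpper 0) MeasurableSet.univ, Set.preimage_univ,
    Measure.volume_pi_eq_dirac 0]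
  simp

/-- In the coordinates `(Z, w, u)` the trace is `w + uᵀZu + Tr Z` and the determinant is `w |Z|`: a
Gaussian in `u`, a gamma integral in `w`, and the induction hypothesis in `Z`. -/
theorem lintegral_exp_neg_trace_mul_det_rpow (d : ℕ) {a : ℝ} (ha : ((d : ℝ) - 1) / 2 < a) :
    ∫⁻ S, ENNReal.ofReal (Real.exp (-S.trace) * S.det ^ (a - ((d : ℝ) + 1) / 2))
      ∂(posDefLebesgue d) = ENNReal.ofReal (gammaProd d a) := by
  induction d with
  | zero => rw [lintegral_posDefLebesgue_zero]; simp [gammaProd]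
  | succ n ih =>
    push_cast at ha ⊢
    have hG : 0 < Real.Gamma (a - n / 2) := Real.Gamma_pos_of_pos (by linarith)
    rw [lintegral_posDefLebesgue_succ, gammaProd_succ, ENNReal.ofReal_mul (by positivity),
      ← ih (by linarith), ← lintegral_ofReal_const_mul _ (by positivity)]
    · refine lintegral_congr_ae (ae_posDef.mono fun Z hZ => ?_)
      have hdet := hZ.det_pos
      have h1 : ∀ w ∈ Set.Ioi (0 : ℝ), (∫⁻ u : Fin n → ℝ, ENNReal.ofReal Z.det *
          ENNReal.ofReal (Real.exp (-(border (w + u ⬝ᵥ (Z *ᵥ u)) (Z *ᵥ u) Z).trace) *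
            (border (w + u ⬝ᵥ (Z *ᵥ u)) (Z *ᵥ u) Z).det ^ (a - ((n : ℝ) + 1 + 1) / 2))) =
          ENNReal.ofReal ((Real.pi ^ ((n : ℝ) / 2) * (Real.exp (-Z.trace) *
            Z.det ^ (a - ((n : ℝ) + 1) / 2))) * (w ^ (a - n / 2 - 1) * Real.exp (-w))) := by
        intro w hw
        have hw' : (0 : ℝ) < w := hw
        have h2 : ∀ u : Fin n → ℝ, ENNReal.ofReal Z.det *
          ENNReal.ofReal (Real.exp (-(border (w + u ⬝ᵥ (Z *ᵥ u)) (Z *ᵥ u) Z).trace) *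
            (border (w + u ⬝ᵥ (Z *ᵥ u)) (Z *ᵥ u) Z).det ^ (a - ((n : ℝ) + 1 + 1) / 2)) =
          ENNReal.ofReal ((Z.det * Real.exp (-w) * Real.exp (-Z.trace) *
            (w * Z.det) ^ (a - ((n : ℝ) + 1 + 1) / 2)) *
            Real.exp (-((u - 0) ⬝ᵥ (Z *ᵥ (u - 0))))) := by
          intro u
          rw [← ENNReal.ofReal_mul hdet.le, trace_border, det_border Z w u hZ, sub_zero, neg_add,
            neg_add, Real.exp_add, Real.exp_add]
          congr 1
          ring
        rw [lintegral_congr h2, lintegral_ofReal_const_mul _ (by positivity),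
          lintegral_exp_neg_quadratic hZ, ← ENNReal.ofReal_mul (by positivity)]
        congr 1
        have h3 : Z.det ^ (a - ((n : ℝ) + 1) / 2) =
            Z.det * Z.det ^ (a - ((n : ℝ) + 1 + 1) / 2) * Z.det ^ (-(1 / 2) : ℝ) := by
          nth_rw 2 [← Real.rpow_one Z.det]
          rw [← Real.rpow_add hdet, ← Real.rpow_add hdet]
          congr 1
          ring
        have h4 : a - (n : ℝ) / 2 - 1 = a - ((n : ℝ) + 1 + 1) / 2 := by ring
        rw [h3, h4, Real.mul_rpow hw'.le hdet.le]
        ring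
      beta_reduce
      rw [setLIntegral_congr_fun measurableSet_Ioi h1, lintegral_ofReal_const_mul _ (by positivity),
        lintegral_rpow_mul_exp_neg (by linarith), ← ENNReal.ofReal_mul (by positivity)]
      congr 1
      ring
    · exact (measurable_trace.neg.exp.mul (measurable_det.pow_const _)).ennreal_ofReal

theorem multiGamma_eq_gammaProd {d : ℕ} {a : ℝ} (ha : ((d : ℝ) - 1) / 2 < a) :
    multiGamma d a = gammaProd d a := by
  rw [multiGamma, integral_eq_lintegral_of_nonneg_ae,
    lintegral_exp_neg_trace_mul_det_rpow d ha, ENNReal.toReal_ofReal (gammaProd_pos ha).le]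
  · exact ae_posDef.mono fun S hS =>
      mul_nonneg (Real.exp_pos _).le (Real.rpow_nonneg hS.det_pos.le _)
  · exact (measurable_trace.neg.exp.mul (measurable_det.pow_const _)).aestronglyMeasurable

/-- The normalizing constant of the inverse Wishart distribution. -/
theorem lintegral_det_rpow_mul_exp_neg_trace_mul_inv (d : ℕ) {a : ℝ} (ha : ((d : ℝ) - 1) / 2 < a)
    {Ψ : Matrix (Fin d) (Fin d) ℝ} (hΨ : Ψ.PosDef) :
    ∫⁻ S, ENNReal.ofReal (S.det ^ (-a - ((d : ℝ) + 1) / 2) * Real.exp (-(Ψ * S⁻¹).trace))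
      ∂(posDefLebesgue d) = ENNReal.ofReal (gammaProd d a * Ψ.det ^ (-a)) := by
  induction d generalizing a with
  | zero => rw [lintegral_posDefLebesgue_zero]; simp [gammaProd]
  | succ n ih =>
    push_cast at ha ⊢
    obtain ⟨k, c, Φ, hk, hΦ, rfl⟩ := exists_eq_border hΨ
    have ha0 : 0 < a := by
      have : (0 : ℝ) ≤ n := n.cast_nonneg
      linarith
    have hG : 0 < Real.Gamma a := Real.Gamma_pos_of_pos ha0
    have hΦd := hΦ.det_pos
    have hconst : gammaProd (n + 1) a * (border (k + c ⬝ᵥ (Φ *ᵥ c)) (Φ *ᵥ c) Φ).det ^ (-a) =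
        (Real.pi ^ ((n : ℝ) / 2) * Real.Gamma a * k ^ (-a) * Φ.det ^ (-(1 / 2) : ℝ)) *
          (gammaProd n (a - 1 / 2) * Φ.det ^ (-(a - 1 / 2))) := by
      have : Φ.det ^ (-a) = Φ.det ^ (-(1 / 2) : ℝ) * Φ.det ^ (-(a - 1 / 2)) := by
        rw [← Real.rpow_add hΦd]; congr 1; ring
      rw [gammaProd_succ', det_border _ _ _ hΦ, Real.mul_rpow hk.le hΦd.le, this]
      ring
    rw [lintegral_posDefLebesgue_succ, hconst, ENNReal.ofReal_mul (by positivity),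
      ← ih (by linarith) hΦ, ← lintegral_ofReal_const_mul _ (by positivity)]
    · refine lintegral_congr_ae (ae_posDef.mono fun Z hZ => ?_)
      have hdet := hZ.det_pos
      have h1 : ∀ w ∈ Set.Ioi (0 : ℝ), (∫⁻ u : Fin n → ℝ, ENNReal.ofReal Z.det *
          ENNReal.ofReal ((border (w + u ⬝ᵥ (Z *ᵥ u)) (Z *ᵥ u) Z).det ^
              (-a - ((n : ℝ) + 1 + 1) / 2) *
            Real.exp (-(border (k + c ⬝ᵥ (Φ *ᵥ c)) (Φ *ᵥ c) Φ *
              (border (w + u ⬝ᵥ (Z *ᵥ u)) (Z *ᵥ u) Z)⁻¹).trace))) =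
          ENNReal.ofReal ((Real.pi ^ ((n : ℝ) / 2) * Φ.det ^ (-(1 / 2) : ℝ) *
            (Z.det ^ (-(a - 1 / 2) - ((n : ℝ) + 1) / 2) * Real.exp (-(Φ * Z⁻¹).trace))) *
              (w ^ (-a - 1) * Real.exp (-(k * w⁻¹)))) := by
        intro w hw
        have hw' : (0 : ℝ) < w := hw
        have h2 : ∀ u : Fin n → ℝ, ENNReal.ofReal Z.det *
          ENNReal.ofReal ((border (w + u ⬝ᵥ (Z *ᵥ u)) (Z *ᵥ u) Z).det ^
              (-a - ((n : ℝ) + 1 + 1) / 2) *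
            Real.exp (-(border (k + c ⬝ᵥ (Φ *ᵥ c)) (Φ *ᵥ c) Φ *
              (border (w + u ⬝ᵥ (Z *ᵥ u)) (Z *ᵥ u) Z)⁻¹).trace)) =
          ENNReal.ofReal ((Z.det * (w * Z.det) ^ (-a - ((n : ℝ) + 1 + 1) / 2) *
            Real.exp (-(k * w⁻¹)) * Real.exp (-(Φ * Z⁻¹).trace)) *
            Real.exp (-((u - c) ⬝ᵥ ((w⁻¹ • Φ) *ᵥ (u - c))))) := by
          intro u
          rw [← ENNReal.ofReal_mul hdet.le, trace_border_mul_inv_border Z hw'.ne' u c k hZ hΦ,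
            det_border Z w u hZ, neg_add, neg_add, Real.exp_add, Real.exp_add]
          congr 1
          ring
        rw [lintegral_congr h2, lintegral_ofReal_const_mul _ (by positivity),
          lintegral_exp_neg_quadratic (hΦ.smul (inv_pos.2 hw')),
          ← ENNReal.ofReal_mul (by positivity)]
        congr 1
        have h3 : Z.det ^ (-(a - 1 / 2) - ((n : ℝ) + 1) / 2) =
            Z.det * Z.det ^ (-a - ((n : ℝ) + 1 + 1) / 2) := by
          nth_rw 2 [← Real.rpow_one Z.det]
          rw [← Real.rpow_add hdet]
          congr 1
          ring
        -- The factor `w^(n/2)` comes from the Gaussian in `u`, whose matrix `w⁻¹Φ` depends on `w`.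
        have h4 : w ^ (-a - 1) = w ^ (-a - ((n : ℝ) + 1 + 1) / 2) * w ^ ((n : ℝ) / 2) := by
          rw [← Real.rpow_add hw']
          congr 1
          ring
        have h5 : (w⁻¹ • Φ).det ^ (-(1 / 2) : ℝ) = w ^ ((n : ℝ) / 2) * Φ.det ^ (-(1 / 2) : ℝ) := by
          rw [det_smul, Fintype.card_fin, Real.mul_rpow (by positivity) hΦd.le,
            ← Real.rpow_natCast, ← Real.rpow_neg_one, ← Real.rpow_mul hw'.le,
            ← Real.rpow_mul hw'.le]
          congr 2
          ring
        rw [h3, h4, h5, Real.mul_rpow hw'.le hdet.le]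
        ring
      beta_reduce
      rw [setLIntegral_congr_fun measurableSet_Ioi h1, lintegral_ofReal_const_mul _ (by positivity),
        lintegral_rpow_mul_exp_neg_inv ha0 hk, ← ENNReal.ofReal_mul (by positivity)]
      congr 1
      ring
    · refine ((measurable_det.pow_const _).mul (Measurable.exp ?_)).ennreal_ofReal
      refine Measurable.neg ?_
      exact ((continuous_const.matrix_mul continuous_id).matrix_trace.measurable).comp
        measurable_inv

/-! ### Normalization of the normal-inverse-Wishart density -/

section law

variable {d : ℕ} {μ₀ : Fin d → ℝ} {lam : ℝ} {Ψ : Matrix (Fin d) (Fin d) ℝ} {ν : ℝ}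

theorem measurable_quadratic :
    Measurable fun x : (Fin d → ℝ) × Matrix (Fin d) (Fin d) ℝ =>
      (x.1 - μ₀) ⬝ᵥ (x.2⁻¹ *ᵥ (x.1 - μ₀)) := by
  have h : Continuous fun x : (Fin d → ℝ) × Matrix (Fin d) (Fin d) ℝ =>
      (x.1 - μ₀) ⬝ᵥ (x.2 *ᵥ (x.1 - μ₀)) :=
    (continuous_fst.sub continuous_const).dotProduct
      (continuous_snd.matrix_mulVec (continuous_fst.sub continuous_const))
  exact h.measurable.comp (measurable_fst.prodMk (measurable_inv.comp measurable_snd))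

theorem measurable_trace_mul_inv (Ψ : Matrix (Fin d) (Fin d) ℝ) :
    Measurable fun S : Matrix (Fin d) (Fin d) ℝ => (Ψ * S⁻¹).trace :=
  ((continuous_const.matrix_mul continuous_id).matrix_trace.measurable).comp measurable_inv

theorem measurable_pdf (μ₀ : Fin d → ℝ) (lam : ℝ) (Ψ : Matrix (Fin d) (Fin d) ℝ) (ν : ℝ) :
    Measurable fun x : (Fin d → ℝ) × Matrix (Fin d) (Fin d) ℝ => pdf μ₀ lam Ψ ν x.1 x.2 := by
  refine Measurable.mul (((measurable_const).mul ((measurable_det.comp measurable_snd).pow_const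
    _)).div_const _) (Measurable.exp (Measurable.sub ?_ (measurable_quadratic.const_mul _)))
  exact ((measurable_trace_mul_inv Ψ).comp measurable_snd).const_mul _

theorem pdf_pos (hlam : 0 < lam) (hΨ : Ψ.PosDef) (hν : (d : ℝ) - 1 < ν) (μ : Fin d → ℝ)
    {S : Matrix (Fin d) (Fin d) ℝ} (hS : S.PosDef) : 0 < pdf μ₀ lam Ψ ν μ S := by
  have h1 := hΨ.det_pos
  have h2 := hS.det_pos
  have h3 := gammaProd_pos (d := d) (a := ν / 2) (by linarith)
  have h4 := Real.pi_pos
  rw [pdf, multiGamma_eq_gammaProd (by linarith)]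
  positivity

theorem ae_prod_posDef :
    ∀ᵐ x ∂((volume : Measure (Fin d → ℝ)).prod (posDefLebesgue d)), x.2.PosDef := by
  have := Measure.quasiMeasurePreserving_snd (μ := (volume : Measure (Fin d → ℝ)))
    (ν := posDefLebesgue d)
  exact this.ae ae_posDef

/-- The Gaussian integral over `μ` contributes `|S|^(1/2)`, leaving the inverse Wishart integral
with `a = ν/2` and matrix `Ψ/2`. -/
theorem lintegral_pdf (hlam : 0 < lam) (hΨ : Ψ.PosDef) (hν : (d : ℝ) - 1 < ν) :
    ∫⁻ x, ENNReal.ofReal (pdf μ₀ lam Ψ ν x.1 x.2)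
      ∂((volume : Measure (Fin d → ℝ)).prod (posDefLebesgue d)) = 1 := by
  have hΨd := hΨ.det_pos
  have hG := gammaProd_pos (d := d) (a := ν / 2) (by linarith)
  have hpi := Real.pi_pos
  set C := (lam ^ ((d : ℝ) / 2) * Ψ.det ^ (ν / 2)) /
    ((2 * Real.pi) ^ ((d : ℝ) / 2) * 2 ^ (ν * d / 2) * gammaProd d (ν / 2)) with hC
  have hC0 : 0 < C := by positivity
  have h2Ψ : ((1 / 2 : ℝ) • Ψ).PosDef := hΨ.smul (by norm_num)
  rw [lintegral_prod_symm' _ (measurable_pdf _ _ _ _).ennreal_ofReal]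
  have h1 : ∀ S : Matrix (Fin d) (Fin d) ℝ, S.PosDef →
      ∫⁻ μ, ENNReal.ofReal (pdf μ₀ lam Ψ ν μ S) =
      ENNReal.ofReal ((C * Real.pi ^ ((d : ℝ) / 2) * (lam / 2) ^ (-(d : ℝ) / 2)) *
        (S.det ^ (-(ν / 2) - ((d : ℝ) + 1) / 2) *
          Real.exp (-(((1 / 2 : ℝ) • Ψ) * S⁻¹).trace))) := by
    intro S hS
    have hSd := hS.det_pos
    have h2 : ∀ μ, ENNReal.ofReal (pdf μ₀ lam Ψ ν μ S) =
        ENNReal.ofReal ((C * S.det ^ (-(ν + d + 2) / 2) *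
          Real.exp (-(((1 / 2 : ℝ) • Ψ) * S⁻¹).trace)) *
            Real.exp (-((μ - μ₀) ⬝ᵥ (((lam / 2) • S⁻¹) *ᵥ (μ - μ₀))))) := by
      intro μ
      rw [pdf, multiGamma_eq_gammaProd (by linarith), sub_eq_add_neg, Real.exp_add, hC,
        Matrix.smul_mul, trace_smul, smul_mulVec, dotProduct_smul, smul_eq_mul, smul_eq_mul,
        neg_mul]
      congr 1
      ring
    rw [lintegral_congr h2, lintegral_ofReal_const_mul _ (by positivity),
      lintegral_exp_neg_quadratic (hS.inv.smul (by positivity)),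
      ← ENNReal.ofReal_mul (by positivity)]
    congr 1
    have h3 : ((lam / 2) • S⁻¹).det ^ (-(1 / 2) : ℝ) =
        (lam / 2) ^ (-(d : ℝ) / 2) * S.det ^ (1 / 2 : ℝ) := by
      rw [det_smul, Fintype.card_fin, det_nonsing_inv, Ring.inverse_eq_inv',
        Real.mul_rpow (by positivity) (by positivity), ← Real.rpow_natCast,
        ← Real.rpow_mul (by positivity), ← Real.rpow_neg_one S.det, ← Real.rpow_mul hSd.le]
      congr 2 <;> ring
    have h4 : S.det ^ (-(ν / 2) - ((d : ℝ) + 1) / 2) =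
        S.det ^ (-(ν + d + 2) / 2) * S.det ^ (1 / 2 : ℝ) := by
      rw [← Real.rpow_add hSd]
      congr 1
      ring
    rw [h3, h4]
    ring
  rw [lintegral_congr_ae (ae_posDef.mono h1), lintegral_ofReal_const_mul _ (by positivity),
    lintegral_det_rpow_mul_exp_neg_trace_mul_inv d (by linarith) h2Ψ,
    ← ENNReal.ofReal_mul (by positivity), ← ENNReal.ofReal_one]
  congr 1
  have h5 : ((1 / 2 : ℝ) • Ψ).det ^ (-(ν / 2)) = 2 ^ (ν * d / 2) * (Ψ.det ^ (ν / 2))⁻¹ := by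
    rw [det_smul, Fintype.card_fin, Real.mul_rpow (by positivity) hΨd.le, Real.rpow_neg hΨd.le,
      ← Real.rpow_natCast, ← Real.rpow_mul (by norm_num), one_div, Real.inv_rpow (by norm_num),
      ← Real.rpow_neg (by norm_num)]
    congr 2
    ring
  have h6 : (lam / 2) ^ (-(d : ℝ) / 2) = 2 ^ ((d : ℝ) / 2) * (lam ^ ((d : ℝ) / 2))⁻¹ := by
    rw [neg_div, Real.rpow_neg (by positivity), Real.div_rpow hlam.le (by norm_num), inv_div]
    rfl
  rw [hC, h5, h6, Real.mul_rpow (by norm_num) hpi.le]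
  field_simp

theorem isProbabilityMeasure_law (hlam : 0 < lam) (hΨ : Ψ.PosDef) (hν : (d : ℝ) - 1 < ν) :
    IsProbabilityMeasure (law μ₀ lam Ψ ν) :=
  ⟨by rw [law, withDensity_apply _ MeasurableSet.univ, Measure.restrict_univ,
    lintegral_pdf hlam hΨ hν]⟩

theorem ae_law_posDef : ∀ᵐ x ∂(law μ₀ lam Ψ ν), x.2.PosDef :=
  (withDensity_absolutelyContinuous _ _).ae_le ae_prod_posDef

end law

/-! ### The exponential family form -/

section exponentialFamily

variable {d : ℕ}

@[simp] theorem block₁_concat (M : Matrix (Fin d) (Fin d) ℝ) (a₂ : Fin d → ℝ) (a₃ a₄ : ℝ) :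
    block₁ (concat (vec M) a₂ a₃ a₄) = M := rfl
@[simp] theorem block₂_concat (a₁ : Fin d × Fin d → ℝ) (a₂ : Fin d → ℝ) (a₃ a₄ : ℝ) :
    block₂ (concat a₁ a₂ a₃ a₄) = a₂ := rfl
@[simp] theorem block₃_concat (a₁ : Fin d × Fin d → ℝ) (a₂ : Fin d → ℝ) (a₃ a₄ : ℝ) :
    block₃ (concat a₁ a₂ a₃ a₄) = a₃ := rfl
@[simp] theorem block₄_concat (a₁ : Fin d × Fin d → ℝ) (a₂ : Fin d → ℝ) (a₃ a₄ : ℝ) :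
    block₄ (concat a₁ a₂ a₃ a₄) = a₄ := rfl

theorem concat_block (η : Param d) :
    concat (vec (block₁ η)) (block₂ η) (block₃ η) (block₄ η) = η := by
  ext i
  rcases i with ⟨i, j⟩ | i | _ | _ <;> rfl

theorem inner_concat_left (M : Matrix (Fin d) (Fin d) ℝ) (a₂ : Fin d → ℝ) (a₃ a₄ : ℝ)
    (η : Param d) :
    inner ℝ (concat (vec M) a₂ a₃ a₄) η =
      (Mᵀ * block₁ η).trace + a₂ ⬝ᵥ block₂ η + a₃ * block₃ η + a₄ * block₄ η := by
  rw [← vec_dotProduct_vec]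
  simp only [PiLp.inner_apply, Fintype.sum_sum_type, dotProduct, concat, block₁, block₂, block₃,
    block₄]
  simp [vec, mul_comm, add_assoc]

/-- The Schur complement `η₁ - η₂ η₂ᵀ / η₃` inside the log partition function. -/
def schur (η : Param d) : Matrix (Fin d) (Fin d) ℝ :=
  block₁ η - (1 / block₃ η) • vecMulVec (block₂ η) (block₂ η)

theorem schur_natParam (μ₀ : Fin d → ℝ) (lam : ℝ)
    (Ψ : Matrix (Fin d) (Fin d) ℝ) (ν : ℝ) : schur (natParam μ₀ lam Ψ ν) = Ψ := by
  ext i j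
  simp only [schur, natParam, block₁_concat, block₂_concat, block₃_concat, Matrix.sub_apply,
    Matrix.add_apply, Matrix.smul_apply, vecMulVec_apply, Pi.smul_apply, smul_eq_mul]
  field_simp
  ring

/-- Recovers `(μ₀, λ, Ψ, ν)` from `η`, so that perturbed natural parameters can be recognized as
members of the family. -/
theorem natParam_schur {η : Param d} (hη : block₃ η ≠ 0) :
    natParam ((block₃ η)⁻¹ • block₂ η) (block₃ η) (schur η) (block₄ η) = η := by
  conv_rhs => rw [← concat_block η]
  rw [natParam]
  congr 1
  · congr 1
    ext i j
    simp [schur, vecMulVec_apply]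
    field_simp
    ring
  · rw [smul_smul, mul_inv_cancel₀ hη, one_smul]

theorem inner_natParam_suffStat (μ₀ : Fin d → ℝ) (lam : ℝ) {Ψ : Matrix (Fin d) (Fin d) ℝ}
    (hΨ : Ψ.PosDef) (ν : ℝ) (μ : Fin d → ℝ) {S : Matrix (Fin d) (Fin d) ℝ} (hS : S.PosDef) :
    inner ℝ (natParam μ₀ lam Ψ ν) (suffStat μ S) =
      -(1 / 2) * (Ψ * S⁻¹).trace - lam / 2 * ((μ - μ₀) ⬝ᵥ (S⁻¹ *ᵥ (μ - μ₀)))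
        - ν / 2 * Real.log S.det := by
  have hsym : (S⁻¹)ᵀ = S⁻¹ := by
    simpa [conjTranspose_eq_transpose_of_trivial] using hS.inv.isHermitian.eq
  have hΨs : Ψᵀ = Ψ := by
    simpa [conjTranspose_eq_transpose_of_trivial] using hΨ.isHermitian.eq
  have hsw : μ ⬝ᵥ (S⁻¹ *ᵥ μ₀) = μ₀ ⬝ᵥ (S⁻¹ *ᵥ μ) := by
    rw [dotProduct_mulVec, ← mulVec_transpose, hsym, dotProduct_comm]
  rw [natParam, suffStat, inner_concat_left, ← vec_smul, block₁_concat, block₂_concat,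
    block₃_concat, block₄_concat, transpose_add, hΨs, transpose_smul, transpose_vecMulVec,
    Matrix.mul_smul, trace_smul, Matrix.add_mul, trace_add, Matrix.smul_mul, trace_smul,
    vecMulVec_mul, trace_vecMulVec, ← mulVec_transpose, hsym, mulVec_sub, sub_dotProduct,
    dotProduct_sub, dotProduct_sub, hsw, smul_dotProduct]
  simp only [smul_eq_mul]
  ring

theorem pdf_eq (μ₀ : Fin d → ℝ) {lam : ℝ} (hlam : 0 < lam) {Ψ : Matrix (Fin d) (Fin d) ℝ}
    (hΨ : Ψ.PosDef) {ν : ℝ} (hν : (d : ℝ) - 1 < ν) (μ : Fin d → ℝ)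
    {S : Matrix (Fin d) (Fin d) ℝ} (hS : S.PosDef) :
    pdf μ₀ lam Ψ ν μ S = baseDensity S *
      Real.exp (inner ℝ (natParam μ₀ lam Ψ ν) (suffStat μ S)
        - logPartition (natParam μ₀ lam Ψ ν)) := by
  have hΨd := hΨ.det_pos
  have hSd := hS.det_pos
  have hG : 0 < multiGamma d (ν / 2) := by
    rw [multiGamma_eq_gammaProd (by linarith)]
    exact gammaProd_pos (by linarith)
  have hpi := Real.pi_pos
  have hA : logPartition (natParam μ₀ lam Ψ ν) = -((d : ℝ) / 2) * Real.log lam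
      - ν / 2 * Real.log Ψ.det + (d : ℝ) / 2 * Real.log (2 * Real.pi)
      + ν * d / 2 * Real.log 2 + Real.log (multiGamma d (ν / 2)) := by
    have := schur_natParam μ₀ lam Ψ ν
    rw [schur] at this
    rw [logPartition, this]
    rfl
  rw [hA, inner_natParam_suffStat μ₀ lam hΨ ν μ hS, pdf, baseDensity]
  -- With every factor an exponential, only an identity of exponents remains.
  have h1 : ∀ {x : ℝ} (_ : 0 < x) (y : ℝ), x ^ y = Real.exp (y * Real.log x) := fun hx y => by
    rw [Real.rpow_def_of_pos hx, mul_comm]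
  rw [h1 hlam, h1 hΨd, h1 hSd, h1 hSd, h1 (by positivity : 0 < 2 * Real.pi), h1 two_pos,
    ← Real.exp_log hG, Real.log_exp]
  simp only [← Real.exp_add, ← Real.exp_sub]
  congr 1
  ring

end exponentialFamily

/-! ### Openness of positive definiteness -/

section openness

open Filter Topology

variable {d : ℕ}

/-- By compactness the quadratic form stays positive on the unit sphere for `M` near `Ψ`;
homogeneity does the rest. -/
theorem eventually_posDef {Ψ : Matrix (Fin d) (Fin d) ℝ} (hΨ : Ψ.PosDef) :
    ∀ᶠ M in 𝓝 Ψ, M.IsHermitian → M.PosDef := by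
  have hK : IsCompact (Metric.sphere (0 : Fin d → ℝ) 1) := isCompact_sphere 0 1
  have hcont : Continuous fun q : Matrix (Fin d) (Fin d) ℝ × (Fin d → ℝ) =>
      q.2 ⬝ᵥ (q.1 *ᵥ q.2) :=
    continuous_snd.dotProduct (continuous_fst.matrix_mulVec continuous_snd)
  have h := hK.eventually_forall_of_forall_eventually (x₀ := Ψ)
    (P := fun M x => 0 < x ⬝ᵥ (M *ᵥ x)) fun x hx =>
      hcont.continuousAt.eventually (lt_mem_nhds (by
        simpa using hΨ.dotProduct_mulVec_pos (ne_zero_of_mem_unit_sphere (⟨x, hx⟩ :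
          Metric.sphere (0 : Fin d → ℝ) 1))))
  filter_upwards [h] with M hM hH
  refine PosDef.of_dotProduct_mulVec_pos hH fun x hx => ?_
  have hx' : 0 < ‖x‖ := norm_pos_iff.2 hx
  have h1 := hM (‖x‖⁻¹ • x) (by simp [norm_smul, hx'.ne'])
  rw [mulVec_smul, smul_dotProduct, dotProduct_smul, smul_eq_mul, smul_eq_mul, ← mul_assoc] at h1
  simpa using pos_of_mul_pos_right h1 (by positivity)

end openness

/-! ### The gradient of the log partition function -/

section gradient

open Filter Topology

variable {d : ℕ}

/-- Jacobi's formula for the derivative of a determinant. -/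
theorem hasDerivAt_det {M : ℝ → Matrix (Fin d) (Fin d) ℝ} {M' : Matrix (Fin d) (Fin d) ℝ} {t : ℝ}
    (h : ∀ i j, HasDerivAt (fun s => M s i j) (M' i j) t) :
    HasDerivAt (fun s => (M s).det) ((M t).adjugate * M').trace t := by
  have h1 : HasDerivAt (fun s => (M s).det) (∑ σ : Equiv.Perm (Fin d),
      ((Equiv.Perm.sign σ : ℤ) : ℝ) *
        ∑ i, (∏ j ∈ Finset.univ.erase i, M t (σ j) j) • M' (σ i) i) t := by
    simp only [det_apply']
    exact HasDerivAt.fun_sum fun σ _ => HasDerivAt.const_mul _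
      (HasDerivAt.fun_finsetProd fun i _ => h (σ i) i)
  convert h1 using 1
  -- Cramer's rule; the trace becomes the sum of determinants with one column differentiated.
  have h2 : ∀ i, ((M t).adjugate * M') i i = ((M t).updateCol i fun k => M' k i).det := fun i => by
    rw [← cramer_apply, cramer_eq_adjugate_mulVec]; rfl
  simp only [trace, diag_apply, h2, det_apply', Finset.mul_sum]
  rw [Finset.sum_comm]
  refine Finset.sum_congr rfl fun σ _ => Finset.sum_congr rfl fun i _ => ?_
  rw [← Finset.prod_erase_mul _ _ (Finset.mem_univ i), smul_eq_mul]
  congr 2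
  · refine Finset.prod_congr rfl fun j hj => ?_
    rw [updateCol_ne (Finset.ne_of_mem_erase hj)]
  · simp

theorem hasDerivAt_log_multiGamma {a : ℝ} (ha : ((d : ℝ) - 1) / 2 < a) :
    HasDerivAt (fun x => Real.log (multiGamma d x))
      (∑ i ∈ Finset.range d, digamma (a - i / 2)) a := by
  have hpos : ∀ {x : ℝ}, ((d : ℝ) - 1) / 2 < x → ∀ i ∈ Finset.range d, 0 < x - i / 2 :=
    fun hx i hi => by
      have : (i : ℝ) + 1 ≤ d := by exact_mod_cast Finset.mem_range.1 hi
      linarith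
  -- The product formula holds only above `(d - 1)/2`, an open condition, which suffices for a
  -- derivative.
  have h1 : (fun x => Real.log (multiGamma d x)) =ᶠ[𝓝 a] fun x =>
      Real.log (Real.pi ^ ((d : ℝ) * (d - 1) / 4)) +
        ∑ i ∈ Finset.range d, Real.log (Real.Gamma (x - i / 2)) := by
    filter_upwards [lt_mem_nhds ha] with x hx
    have h2 : ∀ i ∈ Finset.range d, Real.Gamma (x - i / 2) ≠ 0 := fun i hi =>
      (Real.Gamma_pos_of_pos (hpos hx i hi)).ne'
    rw [multiGamma_eq_gammaProd hx, gammaProd, Real.log_mul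
      (Real.rpow_pos_of_pos Real.pi_pos _).ne' (Finset.prod_ne_zero_iff.2 h2),
      Real.log_prod h2]
  refine HasDerivAt.congr_of_eventuallyEq ?_ h1
  refine HasDerivAt.const_add _ (HasDerivAt.fun_sum fun i hi => ?_)
  have hp := hpos ha i hi
  have hd : HasDerivAt Real.Gamma (deriv Real.Gamma (a - i / 2)) (a - i / 2) :=
    (Real.differentiableAt_Gamma fun m => by
      have : (0 : ℝ) ≤ m := m.cast_nonneg
      linarith).hasDerivAt
  exact (hd.comp_sub_const a _).log (Real.Gamma_pos_of_pos hp).ne'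

/-- The common value of the mean of the sufficient statistics and of the gradient of the log
partition function. -/
def meanParam (μ₀ : Fin d → ℝ) (lam : ℝ) (Ψ : Matrix (Fin d) (Fin d) ℝ) (ν : ℝ) : Param d :=
  concat (-(ν / 2) • vec Ψ⁻¹) (ν • (Ψ⁻¹ *ᵥ μ₀))
    (-(d : ℝ) / (2 * lam) - ν / 2 * (Ψ⁻¹ * vecMulVec μ₀ μ₀).trace)
    (-(1 / 2) * Real.log Ψ.det + (d : ℝ) / 2 * Real.log 2
      + 1 / 2 * ∑ i ∈ Finset.range d, digamma ((ν - i) / 2))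

theorem block₁_add_smul (η v : Param d) (t : ℝ) :
    block₁ (η + t • v) = block₁ η + t • block₁ v := rfl

variable {lam ν : ℝ} {Ψ : Matrix (Fin d) (Fin d) ℝ}

theorem trace_inv_mul_vecMulVec (hΨ : Ψ.PosDef) (u v : Fin d → ℝ) :
    (Ψ⁻¹ * vecMulVec u v).trace = (Ψ⁻¹ *ᵥ v) ⬝ᵥ u := by
  have hsym : (Ψ⁻¹)ᵀ = Ψ⁻¹ := by
    simpa [conjTranspose_eq_transpose_of_trivial] using hΨ.inv.isHermitian.eq
  rw [mul_vecMulVec, trace_vecMulVec, dotProduct_comm, dotProduct_mulVec, ← mulVec_transpose, hsym]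

theorem hasDerivAt_logPartition (μ₀ : Fin d → ℝ) (hlam : 0 < lam) (hΨ : Ψ.PosDef)
    (hν : (d : ℝ) - 1 < ν) (v : Param d) :
    HasDerivAt (fun t : ℝ => logPartition (natParam μ₀ lam Ψ ν + t • v))
      (inner ℝ (meanParam μ₀ lam Ψ ν) v) 0 := by
  have hsym : (Ψ⁻¹)ᵀ = Ψ⁻¹ := by
    simpa [conjTranspose_eq_transpose_of_trivial] using hΨ.inv.isHermitian.eq
  set η := natParam μ₀ lam Ψ ν with hη
  have e2 : block₂ η = lam • μ₀ := rfl
  have e3 : block₃ η = lam := rfl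
  have e4 : block₄ η = ν := rfl
  have hlin : ∀ x y : ℝ, HasDerivAt (fun t : ℝ => x + t * y) y 0 := fun x y => by
    simpa using ((hasDerivAt_id (0 : ℝ)).mul_const y).const_add x
  have h3 : HasDerivAt (fun t : ℝ => block₃ (η + t • v)) (block₃ v) 0 := hlin _ _
  have h4 : HasDerivAt (fun t : ℝ => block₄ (η + t • v)) (block₄ v) 0 := hlin _ _
  have hη0 : η + (0 : ℝ) • v = η := by simp
  have h30 : block₃ (η + (0 : ℝ) • v) = lam := by rw [hη0, e3]
  -- The derivative of `η₁ - η₂η₂ᵀ/η₃` along `v`, simplified by `η₂/η₃ = μ₀`; `v` need not be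
  -- symmetric.
  set N : Matrix (Fin d) (Fin d) ℝ := block₁ v - (vecMulVec (block₂ v) μ₀ + vecMulVec μ₀ (block₂ v))
    + block₃ v • vecMulVec μ₀ μ₀ with hN
  have hs : ∀ i j, HasDerivAt (fun t : ℝ => schur (η + t • v) i j) (N i j) 0 := by
    intro i j
    have h1 : HasDerivAt (fun t : ℝ => block₁ (η + t • v) i j) (block₁ v i j) 0 := hlin _ _
    have h2 : ∀ i, HasDerivAt (fun t : ℝ => block₂ (η + t • v) i) (block₂ v i) 0 :=
      fun i => hlin _ _
    have h := h1.sub ((h3.inv (by rw [h30]; exact hlam.ne')).mul ((h2 i).mul (h2 j)))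
    have hf : (fun t : ℝ => schur (η + t • v) i j) = (fun t : ℝ => block₁ (η + t • v) i j) -
        (fun t : ℝ => block₃ (η + t • v))⁻¹ *
          ((fun t : ℝ => block₂ (η + t • v) i) * fun t : ℝ => block₂ (η + t • v) j) := by
      ext t
      simp [schur, vecMulVec_apply]
    rw [hf]
    refine h.congr_deriv ?_
    simp only [hη0, e2, e3, hN, Matrix.sub_apply, Matrix.add_apply, Matrix.smul_apply,
      vecMulVec_apply, Pi.smul_apply, smul_eq_mul, Pi.mul_apply, Pi.inv_apply]
    field_simp
    ring
  have hs0 : schur (η + (0 : ℝ) • v) = Ψ := by rw [hη0, hη, schur_natParam]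
  have hdet := hasDerivAt_det hs
  have hld := hdet.log (by rw [hs0]; exact hΨ.det_pos.ne')
  have h40 : block₄ (η + (0 : ℝ) • v) / 2 = ν / 2 := by rw [hη0, e4]
  have hg : HasDerivAt (fun t : ℝ => Real.log (multiGamma d (block₄ (η + t • v) / 2)))
      ((∑ i ∈ Finset.range d, digamma (ν / 2 - i / 2)) * (block₄ v / 2)) 0 := by
    have h := hasDerivAt_log_multiGamma (d := d) (a := ν / 2) (by linarith)
    rw [← h40] at h
    have h' := h.comp (0 : ℝ) (h4.div_const 2)
    rw [h40] at h'
    exact h'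
  have hA := (((((h3.log (by rw [h30]; exact hlam.ne')).const_mul (-((d : ℝ) / 2))).sub
    ((h4.div_const 2).mul hld)).add_const ((d : ℝ) / 2 * Real.log (2 * Real.pi))).add
      (((h4.mul_const (d : ℝ)).div_const 2).mul_const (Real.log 2))).add hg
  refine hA.congr_deriv ?_
  have htr : (schur (η + (0 : ℝ) • v)).adjugate = Ψ.det • Ψ⁻¹ := by
    rw [hs0, inv_def, Ring.inverse_eq_inv', smul_smul, mul_inv_cancel₀ hΨ.det_pos.ne', one_smul]
  have hN2 : (Ψ⁻¹ * N).trace = (Ψ⁻¹ * block₁ v).trace - 2 * ((Ψ⁻¹ *ᵥ μ₀) ⬝ᵥ block₂ v)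
      + block₃ v * (Ψ⁻¹ * vecMulVec μ₀ μ₀).trace := by
    have : (Ψ⁻¹ * vecMulVec μ₀ (block₂ v)).trace = (Ψ⁻¹ *ᵥ μ₀) ⬝ᵥ block₂ v := by
      rw [mul_vecMulVec, trace_vecMulVec]
    rw [hN, Matrix.mul_add, Matrix.mul_sub, Matrix.mul_add, trace_add, trace_sub, trace_add, this,
      trace_inv_mul_vecMulVec hΨ, Matrix.mul_smul, trace_smul, smul_eq_mul]
    ring
  rw [htr, Matrix.smul_mul, trace_smul, hN2, hs0, h30, h40, meanParam, ← vec_smul,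
    inner_concat_left, transpose_smul, hsym, Matrix.smul_mul, trace_smul, smul_dotProduct]
  have hdig : ∀ i : ℕ, ν / 2 - (i : ℝ) / 2 = (ν - i) / 2 := fun i => by ring
  simp only [hdig, smul_eq_mul]
  have hΨd := hΨ.det_pos.ne'
  field_simp
  ring

/-- Needed separately, since derivatives along lines alone do not give a Fréchet derivative; they
only identify it. -/
theorem differentiableAt_logPartition (μ₀ : Fin d → ℝ) (hlam : 0 < lam) (hΨ : Ψ.PosDef)
    (hν : (d : ℝ) - 1 < ν) : DifferentiableAt ℝ logPartition (natParam μ₀ lam Ψ ν) := by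
  set η := natParam μ₀ lam Ψ ν with hη
  have e3 : block₃ η = lam := rfl
  have e4 : block₄ η = ν := rfl
  have hc : ∀ k, DifferentiableAt ℝ (fun x : Param d => x k) η := fun k =>
    (EuclideanSpace.proj k : Param d →L[ℝ] ℝ).differentiableAt
  have h3 : DifferentiableAt ℝ (block₃ (d := d)) η := hc _
  have h4 : DifferentiableAt ℝ (block₄ (d := d)) η := hc _
  have h42 : DifferentiableAt ℝ (fun x : Param d => block₄ x / 2) η := by
    simpa only [div_eq_mul_inv] using h4.mul_const (2⁻¹ : ℝ)
  have h4d : DifferentiableAt ℝ (fun x : Param d => block₄ x * d / 2) η := by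
    simpa only [div_eq_mul_inv] using (h4.mul_const (d : ℝ)).mul_const (2⁻¹ : ℝ)
  have h30 : block₃ η ≠ 0 := by rw [e3]; exact hlam.ne'
  have hs : ∀ i j, DifferentiableAt ℝ (fun x : Param d => schur x i j) η := fun i j => by
    simp only [schur, Matrix.sub_apply, Matrix.smul_apply, vecMulVec_apply, smul_eq_mul, one_div]
    exact (hc _).sub ((h3.inv h30).mul ((hc _).mul (hc _)))
  have hdet : DifferentiableAt ℝ (fun x : Param d => (schur x).det) η := by
    simp only [det_apply']
    refine DifferentiableAt.fun_sum fun σ _ => DifferentiableAt.const_mul ?_ _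
    exact (HasFDerivAt.finsetProd (g := fun i (x : Param d) => schur x (σ i) i)
      fun i _ => (hs (σ i) i).hasFDerivAt).differentiableAt
  have hdet0 : (schur η).det ≠ 0 := by
    rw [hη, schur_natParam]
    exact hΨ.det_pos.ne'
  have hg : DifferentiableAt ℝ (fun x : Param d => Real.log (multiGamma d (block₄ x / 2))) η := by
    have h := (hasDerivAt_log_multiGamma (d := d) (a := ν / 2) (by linarith)).differentiableAt
    rw [← e4] at h
    exact h.comp η h42
  exact (((((h3.log h30).const_mul _).sub (h42.mul (hdet.log hdet0))).add_const
    _).add (h4d.mul_const _)).add hg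

theorem hasGradientAt_logPartition (μ₀ : Fin d → ℝ) (hlam : 0 < lam) (hΨ : Ψ.PosDef)
    (hν : (d : ℝ) - 1 < ν) :
    HasGradientAt logPartition (meanParam μ₀ lam Ψ ν) (natParam μ₀ lam Ψ ν) := by
  have hd := differentiableAt_logPartition μ₀ hlam hΨ hν
  rw [hasGradientAt_iff_hasFDerivAt]
  refine hd.hasFDerivAt.congr_fderiv ?_
  ext v
  have h1 := hasDerivAt_logPartition μ₀ hlam hΨ hν v
  have h2 := hd.hasFDerivAt.hasLineDerivAt v
  exact h2.unique h1

end gradient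

/-! ### The mean of the sufficient statistics -/

section mean

open Filter Topology ProbabilityTheory

variable {d : ℕ} {lam ν : ℝ} {Ψ : Matrix (Fin d) (Fin d) ℝ}

/-- The constraints on the parameters are open among symmetric perturbations; symmetry of `block₁ v`
keeps the Schur complement symmetric. -/
theorem eventually_eq_natParam (μ₀ : Fin d → ℝ) (hlam : 0 < lam) (hΨ : Ψ.PosDef)
    (hν : (d : ℝ) - 1 < ν) {v : Param d} (hv : (block₁ v).IsHermitian) :
    ∀ᶠ t : ℝ in 𝓝 0, ∃ (μ' : Fin d → ℝ) (lam' : ℝ) (Ψ' : Matrix (Fin d) (Fin d) ℝ) (ν' : ℝ),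
      0 < lam' ∧ Ψ'.PosDef ∧ (d : ℝ) - 1 < ν' ∧
        natParam μ₀ lam Ψ ν + t • v = natParam μ' lam' Ψ' ν' := by
  set η := natParam μ₀ lam Ψ ν with hη
  have hη0 : η + (0 : ℝ) • v = η := by simp
  have hc : ∀ k, Continuous fun t : ℝ => (η + t • v) k := fun k => by
    simp only [PiLp.add_apply, PiLp.smul_apply, smul_eq_mul]
    fun_prop
  have h3 : ∀ᶠ t : ℝ in 𝓝 0, 0 < block₃ (η + t • v) :=
    (hc _).continuousAt.eventually (lt_mem_nhds (by beta_reduce; rw [hη0]; exact hlam))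
  have h4 : ∀ᶠ t : ℝ in 𝓝 0, (d : ℝ) - 1 < block₄ (η + t • v) :=
    (hc _).continuousAt.eventually (lt_mem_nhds (by beta_reduce; rw [hη0]; exact hν))
  have hs0 : schur (η + (0 : ℝ) • v) = Ψ := by rw [hη0, hη, schur_natParam]
  have hs : ContinuousAt (fun t : ℝ => schur (η + t • v)) 0 := by
    refine continuousAt_pi.2 fun i => continuousAt_pi.2 fun j => ?_
    have : (fun t : ℝ => schur (η + t • v) i j) = fun t => (η + t • v) (Sum.inl (j, i)) -
        ((η + t • v) (Sum.inr (Sum.inr (Sum.inl ()))))⁻¹ *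
          ((η + t • v) (Sum.inr (Sum.inl i)) * (η + t • v) (Sum.inr (Sum.inl j))) := by
      ext t
      simp [schur, vecMulVec_apply, block₁, block₂, block₃]
    rw [this]
    refine (hc _).continuousAt.sub (((hc _).continuousAt.inv₀ ?_).mul
      ((hc _).continuousAt.mul (hc _).continuousAt))
    rw [hη0]
    exact hlam.ne'
  have hpd : ∀ᶠ t : ℝ in 𝓝 0, (schur (η + t • v)).IsHermitian → (schur (η + t • v)).PosDef :=
    hs.eventually (by beta_reduce; rw [hs0]; exact eventually_posDef hΨ)
  filter_upwards [h3, h4, hpd] with t h3 h4 hpd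
  have hvv : ∀ u : Fin d → ℝ, (vecMulVec u u).IsHermitian := fun u => by
    ext i j; simp [vecMulVec_apply, mul_comm]
  have hreal : ∀ (c : ℝ) {M : Matrix (Fin d) (Fin d) ℝ}, M.IsHermitian → (c • M).IsHermitian :=
    fun c M hM => by rw [IsHermitian, conjTranspose_smul, hM.eq, star_trivial]
  refine ⟨_, _, _, _, h3, hpd ?_, h4, (natParam_schur h3.ne').symm⟩
  rw [schur, block₁_add_smul]
  refine IsHermitian.sub (IsHermitian.add ?_ (hreal t hv)) (hreal _ (hvv _))
  exact hΨ.isHermitian.add (hreal lam (hvv μ₀))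

theorem measurable_suffStat :
    Measurable fun x : (Fin d → ℝ) × Matrix (Fin d) (Fin d) ℝ => suffStat x.1 x.2 := by
  have hinv : Measurable fun x : (Fin d → ℝ) × Matrix (Fin d) (Fin d) ℝ => (x.1, x.2⁻¹) :=
    measurable_fst.prodMk (measurable_inv.comp measurable_snd)
  have h1 : Measurable fun x : (Fin d → ℝ) × Matrix (Fin d) (Fin d) ℝ => x.2 *ᵥ x.1 :=
    (continuous_snd.matrix_mulVec continuous_fst).measurable
  have h2 : Measurable fun x : (Fin d → ℝ) × Matrix (Fin d) (Fin d) ℝ => x.1 ⬝ᵥ (x.2 *ᵥ x.1) :=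
    (continuous_fst.dotProduct (continuous_snd.matrix_mulVec continuous_fst)).measurable
  refine (PiLp.continuous_toLp 2 _).measurable.comp (measurable_pi_lambda _ fun k => ?_)
  rcases k with ⟨i, j⟩ | i | _ | _
  · exact ((measurable_matrix_apply j i).comp (measurable_inv.comp measurable_snd)).const_mul _
  · exact (measurable_pi_apply i).comp (h1.comp hinv)
  · exact (h2.comp hinv).const_mul _
  · exact ((measurable_det.comp measurable_snd).log).const_mul _

/-- The tilted density is a constant multiple of the density at `η + tv`, which has total mass one.
-/
theorem lintegral_exp_mul_inner_suffStat (μ₀ : Fin d → ℝ) (hlam : 0 < lam) (hΨ : Ψ.PosDef)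
    (hν : (d : ℝ) - 1 < ν) {v : Param d} (hv : (block₁ v).IsHermitian) :
    ∀ᶠ t : ℝ in 𝓝 0, ∫⁻ x, ENNReal.ofReal (Real.exp (t * inner ℝ v (suffStat x.1 x.2)))
      ∂(law μ₀ lam Ψ ν) = ENNReal.ofReal (Real.exp (logPartition (natParam μ₀ lam Ψ ν + t • v)
        - logPartition (natParam μ₀ lam Ψ ν))) := by
  filter_upwards [eventually_eq_natParam μ₀ hlam hΨ hν hv] with t
    ⟨μ', lam', Ψ', ν', hlam', hΨ', hν', he⟩
  have hm : Measurable fun x : (Fin d → ℝ) × Matrix (Fin d) (Fin d) ℝ =>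
      ENNReal.ofReal (Real.exp (t * inner ℝ v (suffStat x.1 x.2))) :=
    ((measurable_const.inner measurable_suffStat).const_mul t).exp.ennreal_ofReal
  rw [law, lintegral_withDensity_eq_lintegral_mul _ (measurable_pdf _ _ _ _).ennreal_ofReal hm, he]
  have h1 : ∀ᵐ x ∂((volume : Measure (Fin d → ℝ)).prod (posDefLebesgue d)),
      ((fun x : (Fin d → ℝ) × Matrix (Fin d) (Fin d) ℝ =>
        ENNReal.ofReal (pdf μ₀ lam Ψ ν x.1 x.2)) *
        fun x : (Fin d → ℝ) × Matrix (Fin d) (Fin d) ℝ => ENNReal.ofReal (Real.exp (t * inner ℝ v (suffStat x.1 x.2)))) x =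
      ENNReal.ofReal (Real.exp (logPartition (natParam μ' lam' Ψ' ν')
        - logPartition (natParam μ₀ lam Ψ ν)) * pdf μ' lam' Ψ' ν' x.1 x.2) := by
    filter_upwards [ae_prod_posDef] with x hx
    rw [Pi.mul_apply, ← ENNReal.ofReal_mul (pdf_pos hlam hΨ hν x.1 hx).le,
      pdf_eq μ₀ hlam hΨ hν x.1 hx, pdf_eq μ' hlam' hΨ' hν' x.1 hx, ← he, inner_add_left,
      real_inner_smul_left, mul_assoc, ← Real.exp_add, mul_left_comm, ← Real.exp_add]
    congr 3
    ring
  rw [lintegral_congr_ae h1, lintegral_ofReal_const_mul _ (Real.exp_pos _).le,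
    lintegral_pdf hlam' hΨ' hν', mul_one]

theorem integral_inner_suffStat_of_isHermitian (μ₀ : Fin d → ℝ) (hlam : 0 < lam) (hΨ : Ψ.PosDef)
    (hν : (d : ℝ) - 1 < ν) {v : Param d} (hv : (block₁ v).IsHermitian) :
    Integrable (fun x => inner ℝ v (suffStat x.1 x.2)) (law μ₀ lam Ψ ν) ∧
      ∫ x, inner ℝ v (suffStat x.1 x.2) ∂(law μ₀ lam Ψ ν) = inner ℝ (meanParam μ₀ lam Ψ ν) v := by
  set X : (Fin d → ℝ) × Matrix (Fin d) (Fin d) ℝ → ℝ := fun x => inner ℝ v (suffStat x.1 x.2)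
  have hX : Measurable X := measurable_const.inner measurable_suffStat
  have hev := lintegral_exp_mul_inner_suffStat μ₀ hlam hΨ hν hv
  have hm : ∀ t : ℝ, AEStronglyMeasurable (fun x => Real.exp (t * X x)) (law μ₀ lam Ψ ν) :=
    fun t => (hX.const_mul t).exp.aestronglyMeasurable
  -- Exponential moments on both sides of `0` give integrability of `X` and `mgf' 0 = E X`.
  have hmem : 0 ∈ interior (integrableExpSet X (law μ₀ lam Ψ ν)) := by
    rw [mem_interior_iff_mem_nhds]
    filter_upwards [hev] with t ht
    refine ⟨hm t, ?_⟩
    rw [hasFiniteIntegral_iff_ofReal (ae_of_all _ fun _ => (Real.exp_pos _).le), ht]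
    exact ENNReal.ofReal_lt_top
  have hmgf : mgf X (law μ₀ lam Ψ ν) =ᶠ[𝓝 0] fun t =>
      Real.exp (logPartition (natParam μ₀ lam Ψ ν + t • v)
        - logPartition (natParam μ₀ lam Ψ ν)) := by
    filter_upwards [hev] with t ht
    rw [mgf, integral_eq_lintegral_of_nonneg_ae (ae_of_all _ fun _ => (Real.exp_pos _).le) (hm t),
      ht, ENNReal.toReal_ofReal (Real.exp_pos _).le]
  refine ⟨integrable_of_mem_interior_integrableExpSet hmem, ?_⟩
  rw [← deriv_mgf_zero hmem, hmgf.deriv_eq]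
  have hd := ((hasDerivAt_logPartition μ₀ hlam hΨ hν v).sub_const
    (logPartition (natParam μ₀ lam Ψ ν))).exp
  rw [hd.deriv]
  simp

/-- The parameter with symmetrized first block. -/
def symPart (v : Param d) : Param d :=
  concat (vec ((1 / 2 : ℝ) • (block₁ v + (block₁ v)ᵀ))) (block₂ v) (block₃ v) (block₄ v)

theorem isHermitian_block₁_symPart (v : Param d) : (block₁ (symPart v)).IsHermitian := by
  rw [symPart, block₁_concat]
  ext i j
  simp [mul_add, add_comm]

/-- Antisymmetric matrices are orthogonal to symmetric ones. -/
theorem inner_symPart (v : Param d) {s : Param d} (hs : (block₁ s)ᵀ = block₁ s) :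
    inner ℝ (symPart v) s = inner ℝ v s := by
  conv_rhs => rw [← concat_block v]
  rw [symPart, inner_concat_left, inner_concat_left]
  have : (block₁ v * block₁ s).trace = ((block₁ v)ᵀ * block₁ s).trace := by
    rw [← trace_transpose, transpose_mul, hs, trace_mul_comm]
  rw [transpose_smul, transpose_add, transpose_transpose, Matrix.smul_mul, trace_smul,
    Matrix.add_mul, trace_add, this, smul_eq_mul]
  ring

theorem integral_inner_suffStat (μ₀ : Fin d → ℝ) (hlam : 0 < lam) (hΨ : Ψ.PosDef)
    (hν : (d : ℝ) - 1 < ν) (v : Param d) :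
    Integrable (fun x => inner ℝ v (suffStat x.1 x.2)) (law μ₀ lam Ψ ν) ∧
      ∫ x, inner ℝ v (suffStat x.1 x.2) ∂(law μ₀ lam Ψ ν) = inner ℝ v (meanParam μ₀ lam Ψ ν) := by
  obtain ⟨hi, he⟩ := integral_inner_suffStat_of_isHermitian μ₀ hlam hΨ hν
    (isHermitian_block₁_symPart v)
  have hT : ∀ {S : Matrix (Fin d) (Fin d) ℝ}, S.PosDef → ∀ c : ℝ, (c • S⁻¹)ᵀ = c • S⁻¹ :=
    fun hS c => by
      rw [transpose_smul, ← conjTranspose_eq_transpose_of_trivial, hS.inv.isHermitian.eq]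
  have hae : (fun x => inner ℝ (symPart v) (suffStat x.1 x.2)) =ᵐ[law μ₀ lam Ψ ν]
      fun x => inner ℝ v (suffStat x.1 x.2) := by
    filter_upwards [ae_law_posDef] with x hx
    refine inner_symPart v ?_
    rw [suffStat, ← vec_smul, block₁_concat]
    exact hT hx _
  refine ⟨hi.congr hae, ?_⟩
  rw [← integral_congr_ae hae, he, real_inner_comm, inner_symPart]
  rw [meanParam, ← vec_smul, block₁_concat]
  exact hT hΨ _

theorem integrable_suffStat (μ₀ : Fin d → ℝ) (hlam : 0 < lam) (hΨ : Ψ.PosDef)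
    (hν : (d : ℝ) - 1 < ν) :
    Integrable (fun x => suffStat x.1 x.2) (law μ₀ lam Ψ ν) := by
  -- Each coordinate of `s` is its pairing with a basis vector, whose first block may be
  -- non-symmetric.
  refine Integrable.of_eval_piLp fun k => ?_
  have h : ∀ s : Param d, inner ℝ (EuclideanSpace.single k (1 : ℝ)) s = s k := fun s => by
    rw [EuclideanSpace.inner_single_left]; simp
  have := (integral_inner_suffStat μ₀ hlam hΨ hν (EuclideanSpace.single k 1)).1
  simpa only [h] using this

theorem integral_suffStat (μ₀ : Fin d → ℝ) (hlam : 0 < lam) (hΨ : Ψ.PosDef)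
    (hν : (d : ℝ) - 1 < ν) :
    ∫ x, suffStat x.1 x.2 ∂(law μ₀ lam Ψ ν) = meanParam μ₀ lam Ψ ν := by
  refine ext_inner_left ℝ fun v => ?_
  rw [← integral_inner (integrable_suffStat μ₀ hlam hΨ hν),
    (integral_inner_suffStat μ₀ hlam hΨ hν v).2]

end mean

end NIW

end

theorem mainTheorem2 (d : ℕ) (μ₀ : Fin d → ℝ) (lam : ℝ) (Ψ : Matrix (Fin d) (Fin d) ℝ) (ν : ℝ)
    (hlam : 0 < lam) (hΨ : Ψ.PosDef) (hν : (d : ℝ) - 1 < ν) :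
    IsProbabilityMeasure (NIW.law μ₀ lam Ψ ν) ∧
    (∀ (μ : Fin d → ℝ) (S : Matrix (Fin d) (Fin d) ℝ), S.PosDef →
      NIW.pdf μ₀ lam Ψ ν μ S =
        NIW.baseDensity S *
          Real.exp (inner ℝ (NIW.natParam μ₀ lam Ψ ν) (NIW.suffStat μ S)
            - NIW.logPartition (NIW.natParam μ₀ lam Ψ ν))) ∧
    Integrable (fun x => NIW.suffStat x.1 x.2) (NIW.law μ₀ lam Ψ ν) ∧
    HasGradientAt NIW.logPartition (∫ x, NIW.suffStat x.1 x.2 ∂(NIW.law μ₀ lam Ψ ν))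
      (NIW.natParam μ₀ lam Ψ ν) ∧
    ∫ x, NIW.suffStat x.1 x.2 ∂(NIW.law μ₀ lam Ψ ν) =
      NIW.concat
        (-(ν / 2) • vec Ψ⁻¹)
        (ν • (Ψ⁻¹ *ᵥ μ₀))
        (-(d : ℝ) / (2 * lam) - ν / 2 * (Ψ⁻¹ * vecMulVec μ₀ μ₀).trace)
        (-(1 / 2) * Real.log Ψ.det + (d : ℝ) / 2 * Real.log 2
          + 1 / 2 * ∑ i ∈ Finset.range d, NIW.digamma ((ν - i) / 2)) := by
  have hmean := NIW.integral_suffStat μ₀ hlam hΨ hν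
  refine ⟨NIW.isProbabilityMeasure_law hlam hΨ hν,
    fun μ S hS => NIW.pdf_eq μ₀ hlam hΨ hν μ hS, NIW.integrable_suffStat μ₀ hlam hΨ hν, ?_, hmean⟩
  rw [hmean]
  exact NIW.hasGradientAt_logPartition μ₀ hlam hΨ hν
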